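/- **Linear VAE with one latent variable and fixed diagonal encoder variance.** *Setting.* Let $x$ be a random vector in $\mathbb{R}^{D_0}$ with finite second moments, and let $\mathbf A=\mathbb{E}[xx^\top]=\mathbf P\Phi\mathbf P^\top$, where $\mathbf P\in\mathbb{R}^{D_0\times d_0}$ has orthonormal columns and $\Phi\in\mathbb{R}^{d_0\times d_0}$ is the diagonal matrix of the $d_0$ positive eigenvalues of $\mathbf A$. Put $\tilde x=\Phi^{-1/2}\mathbf P^\top x$ and $\mathbf Z=\mathbb{E}[x\tilde x^\top]\in\mathbb{R}^{D_0\times d_0}$. Let $\beta,\eta_{\mathrm{dec}},\eta_{\mathrm{enc}}>0$, $c=\eta_{\mathrm{dec}}/\eta_{\mathrm{enc}}$, and let $\Sigma=\operatorname{diag}(\sigma_1^2,\dots,\sigma_{d_1}^2)$ with $\sigma_i>0$ be fixed. For $\mathbf U\in\mathbb{R}^{D_0\times d_1}$ and $\mathbf V\in\mathbb{R}^{d_1\times d_0}$ consider the loss $$\mathcal L_{\mathrm{VAE}}(\mathbf U,\mathbf V,\Sigma)=\frac1{\eta_{\mathrm{dec}}^2}\Big[\|\mathbf U\mathbf V-\mathbf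 Z\|_F^2+\operatorname{trace}\big((\mathbf U^\top\mathbf U+\beta c^2\mathbf I)\Sigma\big)+\beta c^2\|\mathbf V\|_F^2\Big]-\beta\log|\Sigma| .$$ It is the negative ELBO, up to a factor and constants, of the VAE with encoder $q(z|x)=\mathcal N(\mathbf Wx,\Sigma)$, decoder $p(x|z)=\mathcal N(\mathbf Uz,\eta_{\mathrm{dec}}^2\mathbf I)$ and prior $\mathcal N(0,\eta_{\mathrm{enc}}^2\mathbf I)$, where the encoder matrices $\mathbf W\in\mathbb{R}^{d_1\times D_0}$ belonging to $\mathbf V$ are the solutions of $\mathbf W\mathbf P\Phi^{1/2}=\mathbf V$. Let $\theta_1\ge\theta_2\ge\dots\ge\theta_{d_0}$ be the singular values of $\mathbf Z$, put $\theta_i=0$ for $i>d_0$, and let $\sigma'_1\le\dots\le\sigma'_{d_1}$ be the non-decreasing rearrangement of $\sigma_1,\dots,\sigma_{d_1}$. *Minimizers.* The function $(\mathbf U,\mathbf V)\mapsto\mathcal L_{\mathrm{VAE}}(\mathbf U,\mathbf V,\Sigma)$ has a global minimizer, and $(\mathbf U^*,\mathbf V^*)$ is a global minimizer if and only if $$\mathbf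 U^*=\mathbf R\,\Omega\,\mathbf T^\top,\qquad \mathbf V^*=\mathbf T\,\Lambda\,\mathbf S^\top$$ for some singular value decomposition $\mathbf Z=\mathbf R\Theta\mathbf S^\top$ ($\mathbf R\in\mathbb{R}^{D_0\times D_0}$, $\mathbf S\in\mathbb{R}^{d_0\times d_0}$ orthogonal, $\Theta\in\mathbb{R}^{D_0\times d_0}$ rectangular diagonal with diagonal $\theta_1\ge\theta_2\ge\cdots$) and some orthogonal matrix $\mathbf T\in\mathbb{R}^{d_1\times d_1}$ with $\Sigma=\mathbf T\operatorname{diag}(\sigma_1'^2,\dots,\sigma_{d_1}'^2)\mathbf T^\top$, where $\Omega\in\mathbb{R}^{D_0\times d_1}$ and $\Lambda\in\mathbb{R}^{d_1\times d_0}$ are the rectangular diagonal matrices with diagonal entries $$\omega_i=\sqrt{\max\Big(0,\tfrac{\sqrt\beta\,\eta_{\mathrm{dec}}}{\eta_{\mathrm{enc}}\sigma_i'}\big(\theta_i-\sqrt\beta\,\sigma_i'\tfrac{\eta_{\mathrm{dec}}}{\eta_{\mathrm{enc}}}\big)\Big)},\qquad \lambda_i=\sqrt{\max\Big(0,\tfrac{\eta_{\mathrm{enc}}\sigma_i'}{\sqrt\beta\,\eta_{\mathrm{dec}}}\big(\theta_i-\sqrt\beta\,\sigma_i'\tfrac{\eta_{\mathrm{dec}}}{\eta_{\mathrm{enc}}}\big)\Big)}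 .$$ *Posterior collapse.* Call a latent dimension $i$ collapsed if, for almost every $x$, the coordinate $z_i$ has law $\mathcal N(0,\sigma_i^2)$ under $q(z|x)=\mathcal N(\mathbf Wx,\Sigma)$. For each minimizer $(\mathbf U^*,\mathbf V^*)$ and each encoder matrix $\mathbf W$ belonging to $\mathbf V^*$, the collapsed dimensions are exactly the indices of the zero rows of $\mathbf V^*$, and there are at most $d_1-\operatorname{rank}(\mathbf V^*)$ of them. If $\Sigma=s^2\mathbf I$ ($s>0$) is isotropic, then every minimizer satisfies $\operatorname{rank}(\mathbf V^*)=r:=\#\{i\le d_1:\theta_i>\sqrt\beta\,s\,c\}$, and if $r\ge1$, then for every $k\in\{0,1,\dots,d_1-r\}$ there are a minimizer and an encoder matrix $\mathbf W$ of rank $r$ belonging to it with exactly $k$ collapsed dimensions. In particular ($k=0$, $r<d_1$), a low-rank encoder need not produce posterior collapse. -/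

import Mathlib

open MeasureTheory ProbabilityTheory Matrix

namespace LinearVAE

noncomputable section

/-- The second moment matrix `A = E[x xᵀ]` of a data distribution `μ` on `ℝ^{D₀}`. -/
def secondMoment {D₀ : ℕ} (μ : Measure (EuclideanSpace ℝ (Fin D₀))) :
    Matrix (Fin D₀) (Fin D₀) ℝ :=
  Matrix.of fun i j => ∫ x, x i * x j ∂μ

/-- `A = P diag(φ) Pᵀ` is a reduced eigenvalue decomposition: `P` has orthonormal columns and
`φ` lists the positive eigenvalues of `A` (with multiplicity). -/
structure IsReducedEigenDecomp {D₀ d₀ : ℕ} (A : Matrix (Fin D₀) (Fin D₀) ℝ)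
    (P : Matrix (Fin D₀) (Fin d₀) ℝ) (φ : Fin d₀ → ℝ) : Prop where
  orthonormal : Pᵀ * P = 1
  pos : ∀ j, 0 < φ j
  eq : A = P * Matrix.diagonal φ * Pᵀ

/-- The whitened data `x̃ = Φ^{-1/2} Pᵀ x`, where `Φ = diag(φ)`. -/
def whiten {D₀ d₀ : ℕ} (P : Matrix (Fin D₀) (Fin d₀) ℝ) (φ : Fin d₀ → ℝ)
    (x : EuclideanSpace ℝ (Fin D₀)) : Fin d₀ → ℝ :=
  (Matrix.diagonal (fun j => (√(φ j))⁻¹) * Pᵀ) *ᵥ x.ofLp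

/-- `Z = E[x x̃ᵀ]`. -/
def crossMoment {D₀ d₀ : ℕ} (μ : Measure (EuclideanSpace ℝ (Fin D₀)))
    (P : Matrix (Fin D₀) (Fin d₀) ℝ) (φ : Fin d₀ → ℝ) : Matrix (Fin D₀) (Fin d₀) ℝ :=
  Matrix.of fun i j => ∫ x, x i * whiten P φ x j ∂μ

/-- The squared Frobenius norm. -/
def frobSq {m n : ℕ} (M : Matrix (Fin m) (Fin n) ℝ) : ℝ := ∑ i, ∑ j, M i j ^ 2

/-- The training loss `ℒ_VAE(U, V, Σ)` of the linear VAE with one latent variable, with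
`c = η_dec / η_enc`. -/
def lossVAE {D₀ d₀ d₁ : ℕ} (β ηdec ηenc : ℝ) (Z : Matrix (Fin D₀) (Fin d₀) ℝ)
    (U : Matrix (Fin D₀) (Fin d₁) ℝ) (V : Matrix (Fin d₁) (Fin d₀) ℝ)
    (Sig : Matrix (Fin d₁) (Fin d₁) ℝ) : ℝ :=
  1 / ηdec ^ 2 *
      (frobSq (U * V - Z)
        + Matrix.trace ((Uᵀ * U + (β * (ηdec / ηenc) ^ 2) • (1 : Matrix (Fin d₁) (Fin d₁) ℝ)) * Sig)
        + β * (ηdec / ηenc) ^ 2 * frobSq V)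
    - β * Real.log Sig.det

/-- `(U, V)` is a global minimizer of `ℒ_VAE(·, ·, Σ)`, the encoder variance `Σ` being fixed. -/
def IsMinimizer {D₀ d₀ d₁ : ℕ} (β ηdec ηenc : ℝ) (Z : Matrix (Fin D₀) (Fin d₀) ℝ)
    (Sig : Matrix (Fin d₁) (Fin d₁) ℝ)
    (U : Matrix (Fin D₀) (Fin d₁) ℝ) (V : Matrix (Fin d₁) (Fin d₀) ℝ) : Prop :=
  ∀ (U' : Matrix (Fin D₀) (Fin d₁) ℝ) (V' : Matrix (Fin d₁) (Fin d₀) ℝ),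
    lossVAE β ηdec ηenc Z U V Sig ≤ lossVAE β ηdec ηenc Z U' V' Sig

/-- The `m × n` rectangular diagonal matrix with diagonal entries `a 0, a 1, …`. -/
def rectDiag (m : ℕ) {n : ℕ} (a : Fin n → ℝ) : Matrix (Fin m) (Fin n) ℝ :=
  Matrix.of fun i j => if (i : ℕ) = (j : ℕ) then a j else 0

/-- The singular values of `Z` in non-increasing order, `singVal Z 0` being the largest;
`singVal Z i = 0` for every `i` beyond the number of columns of `Z`. -/
def singVal {m n : ℕ} (Z : Matrix (Fin m) (Fin n) ℝ) (i : ℕ) : ℝ :=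
  (Matrix.toEuclideanLin Z).singularValues i

/-- `Z = R Θ Sᵀ` is a (full) singular value decomposition of `Z`, the diagonal of `Θ` being
in non-increasing order. -/
def IsSVD {m n : ℕ} (Z : Matrix (Fin m) (Fin n) ℝ) (R : Matrix (Fin m) (Fin m) ℝ)
    (S : Matrix (Fin n) (Fin n) ℝ) : Prop :=
  R ∈ Matrix.orthogonalGroup (Fin m) ℝ ∧ S ∈ Matrix.orthogonalGroup (Fin n) ℝ ∧
    Z = R * rectDiag m (fun j : Fin n => singVal Z j) * Sᵀ

/-- The numbers `σ'₁ ≤ σ'₂ ≤ …`: the entries of `σ` in non-decreasing order. -/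
def sorted {d : ℕ} (σ : Fin d → ℝ) : Fin d → ℝ := σ ∘ Tuple.sort σ

/-- `diag(σ₁², …, σ_d²)`. -/
def encVar {d : ℕ} (σ : Fin d → ℝ) : Matrix (Fin d) (Fin d) ℝ :=
  Matrix.diagonal fun i => σ i ^ 2

/-- `T` is an orthogonal matrix which sorts the diagonal of `diag(σ²)` in non-decreasing order:
`diag(σ²) = T diag(σ'²) Tᵀ`. -/
def IsSorting {d : ℕ} (σ : Fin d → ℝ) (T : Matrix (Fin d) (Fin d) ℝ) : Prop :=
  T ∈ Matrix.orthogonalGroup (Fin d) ℝ ∧ encVar σ = T * encVar (sorted σ) * Tᵀ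

/-- The optimal singular values `ω_i` of the decoder. -/
def omega {D₀ d₀ d₁ : ℕ} (β ηdec ηenc : ℝ) (Z : Matrix (Fin D₀) (Fin d₀) ℝ)
    (σ : Fin d₁ → ℝ) (i : Fin d₁) : ℝ :=
  √(max 0 (√β * ηdec / (ηenc * sorted σ i) * (singVal Z i - √β * sorted σ i * (ηdec / ηenc))))

/-- The optimal singular values `λ_i` of the encoder. -/
def lam {D₀ d₀ d₁ : ℕ} (β ηdec ηenc : ℝ) (Z : Matrix (Fin D₀) (Fin d₀) ℝ)
    (σ : Fin d₁ → ℝ) (i : Fin d₁) : ℝ :=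
  √(max 0 (ηenc * sorted σ i / (√β * ηdec) * (singVal Z i - √β * sorted σ i * (ηdec / ηenc))))

/-- The encoder distribution `q(z | x) = 𝒩(W x, Σ)`. -/
def encoder {D₀ d₁ : ℕ} (W : Matrix (Fin d₁) (Fin D₀) ℝ) (Sig : Matrix (Fin d₁) (Fin d₁) ℝ)
    (x : EuclideanSpace ℝ (Fin D₀)) : Measure (EuclideanSpace ℝ (Fin d₁)) :=
  multivariateGaussian (WithLp.toLp 2 (W *ᵥ x.ofLp)) Sig

/-- The collapsed latent dimensions: those `i` for which, for almost every data point `x`, the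
coordinate `z_i` follows `𝒩(0, Σ_ii)` under `q(z | x)`. -/
def collapsedDims {D₀ d₁ : ℕ} (μ : Measure (EuclideanSpace ℝ (Fin D₀)))
    (W : Matrix (Fin d₁) (Fin D₀) ℝ) (Sig : Matrix (Fin d₁) (Fin d₁) ℝ) : Set (Fin d₁) :=
  {i | ∀ᵐ x ∂μ, (encoder W Sig x).map (fun z => z i) = gaussianReal 0 (Sig i i).toNNReal}

/-- `W` is an encoder matrix belonging to `V`: a solution of `W P Φ^{1/2} = V`. -/
def IsEncoderOf {D₀ d₀ d₁ : ℕ} (P : Matrix (Fin D₀) (Fin d₀) ℝ) (φ : Fin d₀ → ℝ)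
    (W : Matrix (Fin d₁) (Fin D₀) ℝ) (V : Matrix (Fin d₁) (Fin d₀) ℝ) : Prop :=
  W * P * Matrix.diagonal (fun j => √(φ j)) = V

end

end LinearVAE

namespace LinearVAE

/-! ### Joint eigenvectors of commuting symmetric operators. -/

section Eigenbasis

variable {E : Type*} [NormedAddCommGroup E] [InnerProductSpace ℝ E]

/-! With `b = √β η_dec / η_enc`, minimizing the loss means minimizing `objective`. It is coercive,
so a minimizer exists. The two stationarity equations, multiplied by `Uᵀ` and `Vᵀ` and compared,
give `Uᵀ U Σ = b² V Vᵀ`. Hence `Uᵀ U` and `Σ` commute and share an eigenbasis `T`, in which `V Vᵀ`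
is diagonal too; the columns of `Vᵀ T` are then orthogonal eigenvectors of `Zᵀ Z`, and the nonzero
ones, normalized, extend to an eigenbasis `S` (`exists_eigenbases_of_stationary`).

A stationary point is thus a partial matching between standard deviations `τ` and singular values
`θ`, and stationarity fixes the entry of each matched pair (`eq_encEntry_of_relation`). A matched
pair contributes `-max 0 (θ - bτ)²` to the objective (`encEntry_gain`). Comparing a minimizer with
the other matchings in the same bases makes its matching one of maximal gain, and exchange arguments
show that such a matching pairs large `θ` with small `τ` and leaves no profitable pair unused
(`exists_sorted_of_optimal_matching`). This is the claimed form (`canonical_of_minimizer`).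

The converse needs no lower bound on the loss. All pairs of the claimed form have the same value by
orthogonal invariance, and some minimizer has this form, so all of them are minimizers.

For collapse, `E[(W x)_i²] = (V Vᵀ)_ii`, so the mean of `z_i` vanishes almost surely exactly when
row `i` of `V` is zero. For isotropic `Σ` every orthogonal `T` is admissible, and its first `r`
columns can be chosen with any allowed number of zero rows. -/

theorem exists_eigenvector_mem [FiniteDimensional ℝ E] {A : E →ₗ[ℝ] E} (hA : A.IsSymmetric)
    {W : Submodule ℝ E}
    (hW : W ≠ ⊥) (hAW : ∀ x ∈ W, A x ∈ W) :
    ∃ (c : ℝ) (w : E), w ∈ W ∧ w ≠ 0 ∧ A w = c • w := by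
  by_contra! hno
  apply hW
  have hs := (hA.restrict_invariant hAW).subsingleton_of_no_eigenvalue_finiteDimensional (by
    intro c
    rw [Submodule.eq_bot_iff]
    intro w hw
    by_contra hne
    refine hno c w w.2 (by simpa using hne) ?_
    have := congrArg Subtype.val (Module.End.mem_eigenspace_iff.1 hw)
    simpa using this)
  exact Submodule.subsingleton_iff_eq_bot.1 hs

/-- Since the operators commute, `B` preserves the part of an eigenspace of `A` lying in `W`, and so
has an eigenvector there. -/
theorem exists_joint_eigenvector_mem [FiniteDimensional ℝ E] {A B : E →ₗ[ℝ] E}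
    (hA : A.IsSymmetric) (hB : B.IsSymmetric)
    (hAB : ∀ x, A (B x) = B (A x)) {W : Submodule ℝ E} (hW : W ≠ ⊥)
    (hAW : ∀ x ∈ W, A x ∈ W) (hBW : ∀ x ∈ W, B x ∈ W) :
    ∃ (c d : ℝ) (w : E), w ∈ W ∧ w ≠ 0 ∧ A w = c • w ∧ B w = d • w := by
  obtain ⟨c, w, hw, hw0, hwc⟩ := exists_eigenvector_mem hA hW hAW
  obtain ⟨d, x, hx, hx0, hxd⟩ := exists_eigenvector_mem hB
    (W := W ⊓ Module.End.eigenspace A c)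
    (by
      intro h
      apply hw0
      have : w ∈ W ⊓ Module.End.eigenspace A c := ⟨hw, Module.End.mem_eigenspace_iff.2 hwc⟩
      rw [h] at this
      simpa using this)
    (by
      rintro x ⟨hx, hxc⟩
      refine ⟨hBW x hx, Module.End.mem_eigenspace_iff.2 ?_⟩
      rw [hAB, Module.End.mem_eigenspace_iff.1 hxc, map_smul])
  exact ⟨c, d, x, hx.1, hx0, Module.End.mem_eigenspace_iff.1 hx.2, hxd⟩

theorem orthonormal_snoc {r : ℕ} {v : Fin r → E} (hv : Orthonormal ℝ v) {w : E} (hw : ‖w‖ = 1)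
    (hvw : ∀ a, inner ℝ (v a) w = 0) :
    Orthonormal ℝ (Fin.snoc v w : Fin (r + 1) → E) := by
  rw [orthonormal_iff_ite] at hv ⊢
  intro i j
  refine Fin.lastCases ?_ (fun i => ?_) i <;> refine Fin.lastCases ?_ (fun j => ?_) j
  · simp [hw]
  · have := real_inner_comm w (v j) ▸ hvw j
    simp [this, (Fin.castSucc_lt_last j).ne']
  · simp [hvw, (Fin.castSucc_lt_last i).ne]
  · simp [hv i j]

/-- An orthonormal family of joint eigenvectors of two commuting symmetric operators extends to
an orthonormal basis of joint eigenvectors. -/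
theorem exists_extension_joint_eigenvectors [FiniteDimensional ℝ E] {A B : E →ₗ[ℝ] E}
    (hA : A.IsSymmetric)
    (hB : B.IsSymmetric) (hAB : ∀ x, A (B x) = B (A x)) {n : ℕ} (hn : Module.finrank ℝ E = n)
    {r : ℕ} (v : Fin r → E) (hv : Orthonormal ℝ v) (hvA : ∀ a, ∃ c : ℝ, A (v a) = c • v a)
    (hvB : ∀ a, ∃ c : ℝ, B (v a) = c • v a) :
    ∃ (h : r ≤ n) (b : Fin n → E), Orthonormal ℝ b ∧ (∀ a, b (Fin.castLE h a) = v a) ∧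
      (∀ i, ∃ c : ℝ, A (b i) = c • b i) ∧ (∀ i, ∃ c : ℝ, B (b i) = c • b i) := by
  have hr : r ≤ n := by
    have := hv.linearIndependent.fintype_card_le_finrank
    simpa [hn] using this
  obtain ⟨m, hm⟩ : ∃ m, n = r + m := ⟨n - r, by omega⟩
  clear hr
  induction m generalizing r with
  | zero =>
    subst hm
    exact ⟨le_rfl, v, hv, fun a => by simp, hvA, hvB⟩
  | succ m ih =>
    -- Symmetric operators having all `v a` as eigenvectors preserve the orthogonal complement of
    -- their span, so a further joint eigenvector can be found there and appended.
    set W : Submodule ℝ E := (Submodule.span ℝ (Set.range v))ᗮ with hWdef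
    have hmem : ∀ x, x ∈ W ↔ ∀ a, inner ℝ (v a) x = 0 := by
      intro x
      rw [hWdef, Submodule.mem_orthogonal]
      constructor
      · intro h a
        exact h _ (Submodule.subset_span ⟨a, rfl⟩)
      · intro h u hu
        induction hu using Submodule.span_induction with
        | mem y hy => obtain ⟨a, rfl⟩ := hy; exact h a
        | zero => simp
        | add y z _ _ hy hz => rw [inner_add_left, hy, hz, add_zero]
        | smul c y _ hy => rw [inner_smul_left, hy, mul_zero]
    have hinv : ∀ C : E →ₗ[ℝ] E, C.IsSymmetric → (∀ a, ∃ c : ℝ, C (v a) = c • v a) →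
        ∀ x ∈ W, C x ∈ W := by
      intro C hC hvC x hx
      rw [hmem] at hx ⊢
      intro a
      obtain ⟨c, hc⟩ := hvC a
      rw [← hC, hc, inner_smul_left, hx a, mul_zero]
    have hW : W ≠ ⊥ := by
      intro h
      have h1 := Submodule.finrank_add_finrank_orthogonal (Submodule.span ℝ (Set.range v))
      rw [← hWdef, h, finrank_bot, finrank_span_eq_card hv.linearIndependent, hn] at h1
      simp at h1
      omega
    obtain ⟨c, d, w, hw, hw0, hwc, hwd⟩ :=
      exists_joint_eigenvector_mem hA hB hAB hW (hinv A hA hvA) (hinv B hB hvB)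
    have hnw : ‖w‖ ≠ 0 := by simpa using hw0
    obtain ⟨h, b, hb, hbv, hbA, hbB⟩ := ih (Fin.snoc v (‖w‖⁻¹ • w))
      (orthonormal_snoc hv (by rw [norm_smul, norm_inv, norm_norm, inv_mul_cancel₀ hnw])
        (fun a => by rw [inner_smul_right, (hmem w).1 hw a, mul_zero]))
      (fun a => by
        refine Fin.lastCases ?_ (fun a => ?_) a
        · exact ⟨c, by simp only [Fin.snoc_last, map_smul, hwc, smul_comm c]⟩
        · simpa using hvA a)
      (fun a => by
        refine Fin.lastCases ?_ (fun a => ?_) a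
        · exact ⟨d, by simp only [Fin.snoc_last, map_smul, hwd, smul_comm d]⟩
        · simpa using hvB a)
      (by omega)
    refine ⟨by omega, b, hb, fun a => ?_, hbA, hbB⟩
    have := hbv a.castSucc
    simpa using this

end Eigenbasis

/-! ### Simultaneous diagonalization in matrix form. -/

section MatrixEigenbasis

theorem orthonormal_columns_iff {n r : ℕ} (M : Matrix (Fin n) (Fin r) ℝ) :
    Orthonormal ℝ (fun a => (WithLp.toLp 2 (M.col a) : EuclideanSpace ℝ (Fin n))) ↔
      Mᵀ * M = 1 := by
  rw [orthonormal_iff_ite, ← Matrix.ext_iff]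
  refine forall_congr' fun a => forall_congr' fun b => ?_
  simp [PiLp.inner_apply, Matrix.mul_apply, Matrix.one_apply, Matrix.col, mul_comm]

/-- Orthonormal columns which are joint eigenvectors of two commuting symmetric matrices extend
to an orthogonal matrix which diagonalizes both. -/
theorem exists_orthogonal_extension {n r : ℕ} {A B : Matrix (Fin n) (Fin n) ℝ} (hA : Aᵀ = A)
    (hB : Bᵀ = B) (hAB : A * B = B * A) (M : Matrix (Fin n) (Fin r) ℝ) (hM : Mᵀ * M = 1)
    (a b : Fin r → ℝ) (hMA : A * M = M * diagonal a) (hMB : B * M = M * diagonal b) :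
    ∃ (h : r ≤ n) (T : Matrix (Fin n) (Fin n) ℝ) (a' b' : Fin n → ℝ),
      T ∈ orthogonalGroup (Fin n) ℝ ∧ T.submatrix id (Fin.castLE h) = M ∧
      A * T = T * diagonal a' ∧ B * T = T * diagonal b' := by
  have key : ∀ {k : ℕ} (C : Matrix (Fin n) (Fin n) ℝ) (N : Matrix (Fin n) (Fin k) ℝ)
      (c : Fin k → ℝ), C * N = N * diagonal c ↔ ∀ i, Matrix.toEuclideanLin C
        (WithLp.toLp 2 (N.col i)) = c i • (WithLp.toLp 2 (N.col i)) := by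
    intro k C N c
    constructor
    · intro h i
      ext j
      have := congrFun (congrFun h j) i
      rw [mul_diagonal] at this
      simp [Matrix.toLpLin_apply, Matrix.mulVec, dotProduct, Matrix.mul_apply, Matrix.col] at this ⊢
      rw [this, mul_comm]
    · intro h
      ext j i
      have := congrArg (fun x : EuclideanSpace ℝ (Fin n) => x j) (h i)
      rw [mul_diagonal]
      simp [Matrix.toLpLin_apply, Matrix.mulVec, dotProduct, Matrix.mul_apply, Matrix.col] at this ⊢
      rw [this, mul_comm]
  have hsym : ∀ C : Matrix (Fin n) (Fin n) ℝ, Cᵀ = C → (Matrix.toEuclideanLin C).IsSymmetric := by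
    intro C hC
    exact Matrix.isSymmetric_toEuclideanLin_iff.2 (by simpa [Matrix.IsHermitian] using hC)
  obtain ⟨h, t, ht, htv, htA, htB⟩ := exists_extension_joint_eigenvectors (hsym A hA) (hsym B hB)
    (by
      intro x
      have := congrArg (fun C => Matrix.toEuclideanLin C x) hAB
      simpa [Matrix.toLpLin_apply] using this) (n := n) (by simp)
    (fun i => WithLp.toLp 2 (M.col i)) ((orthonormal_columns_iff M).2 hM)
    (fun i => ⟨a i, (key A M a).1 hMA i⟩) (fun i => ⟨b i, (key B M b).1 hMB i⟩)
  choose a' ha' using htA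
  choose b' hb' using htB
  set T : Matrix (Fin n) (Fin n) ℝ := Matrix.of fun i j => t j i with hT
  have hcol : ∀ i, WithLp.toLp 2 (T.col i) = t i := fun i => by ext j; simp [hT, Matrix.col]
  refine ⟨h, T, a', b', ?_, ?_, ?_, ?_⟩
  · rw [mem_orthogonalGroup_iff', ← orthonormal_columns_iff]
    simpa only [hcol] using ht
  · ext i j
    have := congrArg (fun x : EuclideanSpace ℝ (Fin n) => x i) (htv j)
    simpa [hT, Matrix.col] using this
  · rw [key]; simpa only [hcol] using ha'
  · rw [key]; simpa only [hcol] using hb'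

theorem orthogonal_transpose_mul {n : ℕ} {T : Matrix (Fin n) (Fin n) ℝ}
    (hT : T ∈ orthogonalGroup (Fin n) ℝ) : Tᵀ * T = 1 :=
  (mem_orthogonalGroup_iff' _ _).1 hT

theorem orthogonal_mul_transpose {n : ℕ} {T : Matrix (Fin n) (Fin n) ℝ}
    (hT : T ∈ orthogonalGroup (Fin n) ℝ) : T * Tᵀ = 1 :=
  (mem_orthogonalGroup_iff _ _).1 hT

theorem mem_orthogonalGroup_of {n : ℕ} {T : Matrix (Fin n) (Fin n) ℝ}
    (hT : Tᵀ * T = 1) : T ∈ orthogonalGroup (Fin n) ℝ :=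
  (mem_orthogonalGroup_iff' _ _).2 hT

/-- Two diagonalizations of a matrix have the same diagonal entries up to order. -/
theorem exists_perm_of_diagonalizations {n : ℕ} {T : Matrix (Fin n) (Fin n) ℝ}
    (hT : T ∈ orthogonalGroup (Fin n) ℝ) {a b : Fin n → ℝ}
    (h : diagonal a * T = T * diagonal b) : ∃ e : Equiv.Perm (Fin n), b = a ∘ e := by
  have hu : diagonal a = T * diagonal b * Tᵀ := by
    rw [← h, Matrix.mul_assoc, orthogonal_mul_transpose hT, Matrix.mul_one]
  -- The roots of the characteristic polynomial recover the diagonal as a multiset; sorting both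
  -- diagonals then yields the permutation.
  have hc : (diagonal a).charpoly = (diagonal b).charpoly := by
    rw [hu, Matrix.mul_assoc, charpoly_mul_comm, Matrix.mul_assoc, orthogonal_transpose_mul hT,
      Matrix.mul_one]
  have hroots : ∀ c : Fin n → ℝ, (diagonal c).charpoly.roots = (List.ofFn c : Multiset ℝ) := by
    intro c
    rw [charpoly_diagonal, Finset.prod, ← Fin.univ_val_map,
      ← Polynomial.roots_multiset_prod_X_sub_C (Multiset.map c Finset.univ.val), Multiset.map_map]
    rfl
  have hp : (List.ofFn a).Perm (List.ofFn b) := by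
    rw [← Multiset.coe_eq_coe, ← hroots, ← hroots, hc]
  have hs : a ∘ Tuple.sort a = b ∘ Tuple.sort b := by
    refine List.ofFn_injective (List.Perm.eq_of_pairwise' (r := (· ≤ ·)) ?_ ?_
      (((Tuple.sort a).ofFn_comp_perm a).trans (hp.trans ((Tuple.sort b).ofFn_comp_perm b).symm)))
    · exact (Tuple.monotone_sort a).sortedLE_ofFn.pairwise
    · exact (Tuple.monotone_sort b).sortedLE_ofFn.pairwise
  refine ⟨(Tuple.sort b).symm.trans (Tuple.sort a), funext fun i => ?_⟩
  have := congrFun hs ((Tuple.sort b).symm i)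
  simpa using this.symm

theorem eq_of_diagonalizations_of_antitone {n : ℕ} {T : Matrix (Fin n) (Fin n) ℝ}
    (hT : T ∈ orthogonalGroup (Fin n) ℝ) {a b : Fin n → ℝ}
    (h : diagonal a * T = T * diagonal b) (ha : Antitone a) (hb : Antitone b) : a = b := by
  obtain ⟨e, rfl⟩ := exists_perm_of_diagonalizations hT h
  exact Tuple.unique_antitone (σ := 1) (τ := e) ha hb

end MatrixEigenbasis

/-! ### Singular values as eigenvalues of the Gram matrix. -/

section SingularValues

variable {m n : ℕ} (Z : Matrix (Fin m) (Fin n) ℝ)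

theorem singVal_nonneg (i : ℕ) : 0 ≤ singVal Z i := LinearMap.singularValues_nonneg _ i

theorem singVal_antitone : Antitone (singVal Z) := LinearMap.singularValues_antitone _

theorem singVal_of_le {i : ℕ} (hi : n ≤ i) : singVal Z i = 0 :=
  LinearMap.singularValues_of_finrank_le _ (by simpa using hi)

/-- The squares of the singular values are the sorted eigenvalues of `Zᵀ Z`. -/
theorem sq_singVal_eq {S : Matrix (Fin n) (Fin n) ℝ} (hS : S ∈ orthogonalGroup (Fin n) ℝ)
    {c : Fin n → ℝ} (h : Zᵀ * Z * S = S * diagonal c) (hc : Antitone c) (i : Fin n) :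
    singVal Z i ^ 2 = c i := by
  set L := Matrix.toEuclideanLin Z
  have hsym := L.isSymmetric_adjoint_comp_self
  have hfin : Module.finrank ℝ (EuclideanSpace ℝ (Fin n)) = n := by simp
  set d := hsym.eigenvalues hfin
  set t := hsym.eigenvectorBasis hfin
  set T : Matrix (Fin n) (Fin n) ℝ := Matrix.of fun i j => t j i with hTdef
  have hcol : ∀ i, WithLp.toLp 2 (T.col i) = t i := fun i => by ext j; simp [hTdef, Matrix.col]
  have hT : T ∈ orthogonalGroup (Fin n) ℝ := by
    apply mem_orthogonalGroup_of
    rw [← orthonormal_columns_iff]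
    simpa only [hcol] using t.orthonormal
  have hTd : Zᵀ * Z * T = T * diagonal d := by
    ext j i
    have h1 : LinearMap.adjoint L (L (t i)) = d i • t i := hsym.apply_eigenvectorBasis hfin i
    rw [← Matrix.toEuclideanLin_conjTranspose_eq_adjoint] at h1
    have h2 := congrArg (fun x : EuclideanSpace ℝ (Fin n) => x j) h1
    rw [mul_diagonal]
    simpa [L, hTdef, Matrix.toLpLin_apply, Matrix.mulVec, dotProduct, Matrix.mul_apply,
      mul_comm (d i)] using h2
  have : d = c := by
    -- `Tᵀ S` intertwines the two diagonal forms of `Zᵀ Z`; both are non-increasing, so they agree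
    -- entry by entry.
    refine eq_of_diagonalizations_of_antitone (T := Tᵀ * S) ?_ ?_
      (hsym.eigenvalues_antitone hfin) hc
    · apply mem_orthogonalGroup_of
      rw [transpose_mul, transpose_transpose, Matrix.mul_assoc, ← Matrix.mul_assoc T,
        orthogonal_mul_transpose hT, Matrix.one_mul, orthogonal_transpose_mul hS]
    · have h2 : diagonal d * Tᵀ = Tᵀ * (Zᵀ * Z) := by
        have := congrArg transpose hTd
        simpa [transpose_mul] using this.symm
      rw [← Matrix.mul_assoc, h2, Matrix.mul_assoc, h, Matrix.mul_assoc]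
  rw [← this]
  exact LinearMap.sq_singularValues_fin L hfin i

end SingularValues

/-! ### Extending a partial sorted enumeration. -/

section Sorting

/-- An injective enumeration along which `t` is sorted, and whose values are at most the
remaining ones, extends to a sorting permutation. -/
theorem exists_sorting_extension {n r : ℕ} (t : Fin n → ℝ) (f : Fin r → Fin n)
    (hf : Function.Injective f) (hmono : Monotone (t ∘ f))
    (hle : ∀ k, (∀ a, f a ≠ k) → ∀ a, t (f a) ≤ t k) :
    ∃ (h : r ≤ n) (e : Equiv.Perm (Fin n)), (∀ a, e (Fin.castLE h a) = f a) ∧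
      Monotone (t ∘ e) := by
  have hr : r ≤ n := by simpa using Fintype.card_le_of_injective f hf
  obtain ⟨m, hm⟩ : ∃ m, n = r + m := ⟨n - r, by omega⟩
  clear hr
  induction m generalizing r with
  | zero =>
    subst hm
    exact ⟨le_rfl, Equiv.ofBijective f (Finite.injective_iff_bijective.1 hf),
      fun a => by simp, by simpa using hmono⟩
  | succ m ih =>
    have hne : (Finset.univ.filter fun k => ∀ a, f a ≠ k).Nonempty := by
      by_contra h
      have hsurj : Function.Surjective f := by
        intro k
        by_contra hk
        exact h ⟨k, by simpa using hk⟩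
      have := Fintype.card_le_of_surjective f hsurj
      simp at this
      omega
    -- A minimal unused index comes next; minimality preserves the hypothesis on the remaining
    -- indices.
    obtain ⟨k, hk, hkmin⟩ := Finset.exists_min_image _ t hne
    simp only [Finset.mem_filter, Finset.mem_univ, true_and] at hk hkmin
    obtain ⟨h, e, he, hem⟩ := ih (Fin.snoc f k : Fin (r + 1) → Fin n)
      (Fin.snoc_injective_of_injective hf fun ⟨a, ha⟩ => hk a ha)
      (by
        intro a b
        refine Fin.lastCases ?_ (fun a => ?_) a <;> refine Fin.lastCases ?_ (fun b => ?_) b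
        · simp
        · intro hab; exact absurd (Fin.castSucc_lt_last b) (not_lt.2 hab)
        · intro _; simpa using hle k hk a
        · intro hab; simpa using hmono (by simpa using hab))
      (by
        intro l hl a
        have hl' : ∀ a, f a ≠ l := fun a => by simpa using hl a.castSucc
        refine Fin.lastCases ?_ (fun a => ?_) a
        · simpa using hkmin l hl'
        · simpa using hle l hl' a)
      (by omega)
    refine ⟨by omega, e, fun a => ?_, hem⟩
    have := he a.castSucc
    simpa using this

end Sorting

/-! ### Reduction of the loss. -/

noncomputable section

/-- The part of the loss which depends on `U` and `V`, with `b = √β η_dec / η_enc`. -/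
def objective {D₀ d₀ d₁ : ℕ} (b : ℝ) (Z : Matrix (Fin D₀) (Fin d₀) ℝ)
    (Sig : Matrix (Fin d₁) (Fin d₁) ℝ)
    (U : Matrix (Fin D₀) (Fin d₁) ℝ) (V : Matrix (Fin d₁) (Fin d₀) ℝ) : ℝ :=
  frobSq (U * V - Z) + trace ((Uᵀ * U + b ^ 2 • (1 : Matrix (Fin d₁) (Fin d₁) ℝ)) * Sig)
    + b ^ 2 * frobSq V

end

/-- For fixed `Σ` the log-determinant is an additive constant and `1 / η_dec²` a positive factor, so
neither affects the minimizers. -/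
theorem isMinimizer_iff {D₀ d₀ d₁ : ℕ} {β ηdec ηenc : ℝ} (hβ : 0 < β) (hdec : 0 < ηdec)
    (Z : Matrix (Fin D₀) (Fin d₀) ℝ) (Sig : Matrix (Fin d₁) (Fin d₁) ℝ)
    (U : Matrix (Fin D₀) (Fin d₁) ℝ) (V : Matrix (Fin d₁) (Fin d₀) ℝ) :
    IsMinimizer β ηdec ηenc Z Sig U V ↔
      ∀ U' V', objective (√β * (ηdec / ηenc)) Z Sig U V ≤
        objective (√β * (ηdec / ηenc)) Z Sig U' V' := by
  have hb : (√β * (ηdec / ηenc)) ^ 2 = β * (ηdec / ηenc) ^ 2 := by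
    rw [mul_pow, Real.sq_sqrt hβ.le]
  refine forall_congr' fun U' => forall_congr' fun V' => ?_
  have hpos : 0 < 1 / ηdec ^ 2 := by positivity
  rw [lossVAE, lossVAE, objective, objective, hb, sub_le_sub_iff_right, mul_le_mul_iff_right₀ hpos]

/-! ### The squared Frobenius norm. -/

section Frobenius

variable {m n : ℕ}

theorem frobSq_eq_trace (M : Matrix (Fin m) (Fin n) ℝ) : frobSq M = trace (Mᵀ * M) := by
  rw [frobSq, Finset.sum_comm]
  simp [trace, Matrix.mul_apply, sq]

theorem frobSq_nonneg (M : Matrix (Fin m) (Fin n) ℝ) : 0 ≤ frobSq M :=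
  Finset.sum_nonneg fun _ _ => Finset.sum_nonneg fun _ _ => sq_nonneg _

theorem sq_apply_le_frobSq (M : Matrix (Fin m) (Fin n) ℝ) (i : Fin m) (j : Fin n) :
    M i j ^ 2 ≤ frobSq M :=
  (Finset.single_le_sum (f := fun j => M i j ^ 2) (fun _ _ => sq_nonneg _)
    (Finset.mem_univ j)).trans
    (Finset.single_le_sum (f := fun i => ∑ j, M i j ^ 2)
      (fun _ _ => Finset.sum_nonneg fun _ _ => sq_nonneg _) (Finset.mem_univ i))

theorem eq_zero_of_frobSq_eq_zero {M : Matrix (Fin m) (Fin n) ℝ} (h : frobSq M = 0) : M = 0 := by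
  ext i j
  have := sq_apply_le_frobSq M i j
  exact pow_eq_zero_iff two_ne_zero |>.1 (le_antisymm (h ▸ this) (sq_nonneg _))

theorem frobSq_add_smul (M N : Matrix (Fin m) (Fin n) ℝ) (t : ℝ) :
    frobSq (M + t • N) = frobSq M + 2 * t * trace (Mᵀ * N) + t ^ 2 * frobSq N := by
  have h : trace (Nᵀ * M) = trace (Mᵀ * N) := by
    rw [← trace_transpose, transpose_mul, transpose_transpose]
  simp only [frobSq_eq_trace, transpose_add, transpose_smul, Matrix.add_mul, Matrix.mul_add,
    Matrix.smul_mul, Matrix.mul_smul, trace_add, trace_smul, h, smul_eq_mul]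
  ring

end Frobenius

/-- This stands in for differentiation: along a line the increment of the objective is such a
quadratic, and at a minimum its linear coefficient must vanish. -/
theorem eq_zero_of_forall_quadratic_nonneg {p q : ℝ} (h : ∀ t : ℝ, 0 ≤ 2 * t * p + t ^ 2 * q) :
    p = 0 := by
  by_contra hp
  have hq : 0 < |q| + 1 := by positivity
  -- A step against the sign of `p`, short enough that the linear term dominates whatever the sign
  -- of `q`.
  have h1 := h (-p / (|q| + 1))
  have h2 : 2 * (-p / (|q| + 1)) * p + (-p / (|q| + 1)) ^ 2 * q =
      p ^ 2 / (|q| + 1) ^ 2 * (q - 2 * (|q| + 1)) := by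
    field_simp
    ring
  rw [h2] at h1
  have h3 : 0 < p ^ 2 / (|q| + 1) ^ 2 := by positivity
  nlinarith [le_abs_self q, abs_nonneg q]

/-! ### First-order conditions. -/

section Stationary

variable {D₀ d₀ d₁ : ℕ} {b : ℝ} {Z : Matrix (Fin D₀) (Fin d₀) ℝ}
  {Sig : Matrix (Fin d₁) (Fin d₁) ℝ} {U : Matrix (Fin D₀) (Fin d₁) ℝ}
  {V : Matrix (Fin d₁) (Fin d₀) ℝ}

/-- The left-hand side `H` is half the gradient in `U`. Perturbing `U` along `H` itself makes the
linear coefficient `frobSq H`, which therefore vanishes. -/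
theorem stationary_left (hSig : Sigᵀ = Sig)
    (h : ∀ U' V', objective b Z Sig U V ≤ objective b Z Sig U' V') :
    (U * V - Z) * Vᵀ + U * Sig = 0 := by
  set H := (U * V - Z) * Vᵀ + U * Sig with hH
  apply eq_zero_of_frobSq_eq_zero
  apply eq_zero_of_forall_quadratic_nonneg (q := frobSq (H * V) + trace (Hᵀ * H * Sig))
  intro t
  have h1 := h (U + t • H) V
  have h2 : (U + t • H) * V - Z = (U * V - Z) + t • (H * V) := by
    rw [Matrix.add_mul, Matrix.smul_mul]; abel
  have h3 : frobSq H = trace ((U * V - Z)ᵀ * (H * V)) + trace (Uᵀ * H * Sig) := by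
    rw [frobSq_eq_trace]
    conv_lhs => rw [hH, transpose_add, Matrix.add_mul, trace_add, ← hH]
    rw [transpose_mul, transpose_mul, transpose_transpose, hSig, Matrix.mul_assoc V,
      trace_mul_comm V, Matrix.mul_assoc, Matrix.mul_assoc Sig, trace_mul_comm Sig]
  have h4 : trace (Hᵀ * U * Sig) = trace (Uᵀ * H * Sig) := by
    rw [← trace_transpose, transpose_mul, transpose_mul, transpose_transpose, hSig,
      trace_mul_comm]
  rw [objective, objective, h2, frobSq_add_smul] at h1
  simp only [transpose_add, transpose_smul, Matrix.add_mul, Matrix.mul_add,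
    Matrix.smul_mul, Matrix.mul_smul, trace_add, trace_smul, h4, smul_eq_mul] at h1
  rw [h3]
  nlinarith

theorem stationary_right (h : ∀ U' V', objective b Z Sig U V ≤ objective b Z Sig U' V') :
    Uᵀ * (U * V - Z) + b ^ 2 • V = 0 := by
  set H := Uᵀ * (U * V - Z) + b ^ 2 • V with hH
  apply eq_zero_of_frobSq_eq_zero
  apply eq_zero_of_forall_quadratic_nonneg (q := frobSq (U * H) + b ^ 2 * frobSq H)
  intro t
  have h1 := h U (V + t • H)
  have h2 : U * (V + t • H) - Z = (U * V - Z) + t • (U * H) := by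
    rw [Matrix.mul_add, Matrix.mul_smul]; abel
  have h3 : frobSq H = trace ((U * V - Z)ᵀ * (U * H)) + b ^ 2 * trace (Vᵀ * H) := by
    rw [frobSq_eq_trace]
    conv_lhs => rw [hH, transpose_add, Matrix.add_mul, trace_add, ← hH]
    rw [transpose_mul, transpose_smul, transpose_transpose, Matrix.smul_mul, trace_smul,
      smul_eq_mul, Matrix.mul_assoc]
  have h4 := congrArg (fun x => 2 * t * x) h3
  rw [objective, objective, h2, frobSq_add_smul, frobSq_add_smul] at h1
  linarith

end Stationary

/-! ### Coercivity and existence of a minimizer. -/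

section Existence

variable {D₀ d₀ d₁ : ℕ}

theorem trace_mul_encVar (U : Matrix (Fin D₀) (Fin d₁) ℝ) (b : ℝ) (σ : Fin d₁ → ℝ) :
    trace ((Uᵀ * U + b ^ 2 • (1 : Matrix (Fin d₁) (Fin d₁) ℝ)) * encVar σ) =
      frobSq (U * diagonal σ) + b ^ 2 * ∑ i, σ i ^ 2 := by
  have h : encVar σ = diagonal σ * diagonal σ := by
    simp [encVar, diagonal_mul_diagonal, sq]
  have h2 : trace (encVar σ) = ∑ i, σ i ^ 2 := by simp [encVar, trace]
  rw [Matrix.add_mul, trace_add, Matrix.smul_mul, Matrix.one_mul, trace_smul, h2, h,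
    frobSq_eq_trace, transpose_mul, diagonal_transpose, ← Matrix.mul_assoc, trace_mul_comm]
  simp only [Matrix.mul_assoc, smul_eq_mul]

theorem exists_objective_minimizer {b : ℝ} (hb : 0 < b) (Z : Matrix (Fin D₀) (Fin d₀) ℝ)
    {σ : Fin d₁ → ℝ} (hσ : ∀ i, 0 < σ i) :
    ∃ (U : Matrix (Fin D₀) (Fin d₁) ℝ) (V : Matrix (Fin d₁) (Fin d₀) ℝ),
      ∀ U' V', objective b Z (encVar σ) U V ≤ objective b Z (encVar σ) U' V' := by
  let F : (Fin D₀ → Fin d₁ → ℝ) × (Fin d₁ → Fin d₀ → ℝ) → ℝ := fun x =>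
    objective b Z (encVar σ) (Matrix.of x.1) (Matrix.of x.2)
  have hF : Continuous F := by
    simp only [F, objective, frobSq, trace, Matrix.mul_apply, Matrix.diag, Matrix.sub_apply,
      Matrix.add_apply, Matrix.of_apply, Matrix.transpose_apply]
    fun_prop
  obtain ⟨m, hm, hmσ⟩ : ∃ m > 0, ∀ i, m ≤ σ i := by
    rcases isEmpty_or_nonempty (Fin d₁) with h | h
    · exact ⟨1, one_pos, fun i => h.elim i⟩
    · obtain ⟨i, hi⟩ := Finite.exists_min σ
      exact ⟨σ i, hσ i, hi⟩
  -- The sublevel set at the value of the origin is nonempty. It is bounded because positive `σ i`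
  -- and `b` let the two penalties control every entry of `U` and `V`.
  set C := F 0
  have hbound : ∀ x, F x ≤ C → ‖x‖ ≤ √C / m + √C / b := by
    intro x hx
    have hC : F x = frobSq (Matrix.of x.1 * Matrix.of x.2 - Z) +
        (frobSq (Matrix.of x.1 * diagonal σ) + b ^ 2 * ∑ i, σ i ^ 2) +
        b ^ 2 * frobSq (Matrix.of x.2) := by
      rw [← trace_mul_encVar]; rfl
    have h0 := frobSq_nonneg (Matrix.of x.1 * Matrix.of x.2 - Z)
    have h1 := frobSq_nonneg (Matrix.of x.1 * diagonal σ)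
    have h2 : 0 ≤ b ^ 2 * ∑ i, σ i ^ 2 := by positivity
    have h3 : 0 ≤ b ^ 2 * frobSq (Matrix.of x.2) := mul_nonneg (sq_nonneg b) (frobSq_nonneg _)
    have hm0 : 0 ≤ √C / m := by positivity
    have hb0 : 0 ≤ √C / b := by positivity
    rw [Prod.norm_def]
    refine max_le ?_ ?_
    · refine (pi_norm_le_iff_of_nonneg (by positivity)).2 fun i =>
        (pi_norm_le_iff_of_nonneg (by positivity)).2 fun j => ?_
      refine le_trans ?_ (le_add_of_nonneg_right hb0)
      rw [le_div_iff₀ hm, Real.norm_eq_abs]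
      have h4 := sq_apply_le_frobSq (Matrix.of x.1 * diagonal σ) i j
      rw [mul_diagonal, Matrix.of_apply] at h4
      have h5 : |x.1 i j * σ j| ≤ √C := Real.abs_le_sqrt (by linarith)
      rw [abs_mul, abs_of_pos (hσ j)] at h5
      exact (mul_le_mul_of_nonneg_left (hmσ j) (abs_nonneg _)).trans h5
    · refine (pi_norm_le_iff_of_nonneg (by positivity)).2 fun i =>
        (pi_norm_le_iff_of_nonneg (by positivity)).2 fun j => ?_
      refine le_trans ?_ (le_add_of_nonneg_left hm0)
      rw [le_div_iff₀ hb, Real.norm_eq_abs]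
      have h4 := sq_apply_le_frobSq (Matrix.of x.2) i j
      rw [Matrix.of_apply] at h4
      have h5 : |x.2 i j * b| ≤ √C := Real.abs_le_sqrt (by nlinarith)
      rwa [abs_mul, abs_of_pos hb] at h5
  have hK : IsCompact {x | F x ≤ C} :=
    Metric.isCompact_of_isClosed_isBounded (isClosed_le hF continuous_const)
      (isBounded_iff_forall_norm_le.2 ⟨_, hbound⟩)
  obtain ⟨x, hx, hmin⟩ := hK.exists_isMinOn ⟨0, le_refl C⟩ hF.continuousOn
  refine ⟨Matrix.of x.1, Matrix.of x.2, fun U' V' => ?_⟩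
  change F x ≤ F (Matrix.of.symm U', Matrix.of.symm V')
  rcases le_total (F (Matrix.of.symm U', Matrix.of.symm V')) C with h | h
  · exact hmin h
  · exact le_trans hx h

end Existence

/-- The product is a sum of rank-one terms indexed by columns, so vanishing columns of `X` can be
dropped. -/
theorem mul_diagonal_mul_transpose_restrict {m k n r : ℕ} (X : Matrix (Fin m) (Fin n) ℝ)
    (Y : Matrix (Fin k) (Fin n) ℝ) (w : Fin n → ℝ) {f : Fin r → Fin n}
    (hf : Function.Injective f) (hX : ∀ i, (∀ a, f a ≠ i) → ∀ j, X j i = 0) :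
    X * diagonal w * Yᵀ =
      X.submatrix id f * diagonal (w ∘ f) * (Y.submatrix id f)ᵀ := by
  ext i j
  simp only [Matrix.mul_apply (M := _ * _), mul_diagonal, transpose_apply, submatrix_apply, id,
    Function.comp]
  have hmap := Finset.sum_map Finset.univ ⟨f, hf⟩ (fun x => X i x * w x * Y j x)
  simp only [Function.Embedding.coeFn_mk] at hmap
  rw [← hmap]
  refine (Finset.sum_subset (Finset.subset_univ _) fun x _ hx => ?_).symm
  rw [hX x (fun a ha => hx (by simpa using ⟨a, ha⟩)), zero_mul, zero_mul]

/-! ### Shape of the stationary points. -/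

section Structure

variable {D₀ d₀ d₁ : ℕ} {b : ℝ} {Z : Matrix (Fin D₀) (Fin d₀) ℝ}
  {Sig : Matrix (Fin d₁) (Fin d₁) ℝ} {U : Matrix (Fin D₀) (Fin d₁) ℝ}
  {V : Matrix (Fin d₁) (Fin d₀) ℝ}

/-- A stationary point is diagonal with respect to suitable orthonormal eigenbases of `Σ` and
`Zᵀ Z`. -/
theorem exists_eigenbases_of_stationary (hb : 0 < b) (hSig : Sigᵀ = Sig)
    (hpos : ∀ (T : Matrix (Fin d₁) (Fin d₁) ℝ) (s : Fin d₁ → ℝ),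
      T ∈ orthogonalGroup (Fin d₁) ℝ → Sig * T = T * diagonal s → ∀ i, 0 < s i)
    (h1 : (U * V - Z) * Vᵀ + U * Sig = 0) (h2 : Uᵀ * (U * V - Z) + b ^ 2 • V = 0) :
    ∃ (T : Matrix (Fin d₁) (Fin d₁) ℝ) (s : Fin d₁ → ℝ) (S : Matrix (Fin d₀) (Fin d₀) ℝ)
      (c : Fin d₀ → ℝ) (r : ℕ) (f : Fin r → Fin d₁) (g : Fin r → Fin d₀) (l : Fin r → ℝ),
      T ∈ orthogonalGroup (Fin d₁) ℝ ∧ Sig * T = T * diagonal s ∧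
      S ∈ orthogonalGroup (Fin d₀) ℝ ∧ Zᵀ * Z * S = S * diagonal c ∧
      Function.Injective f ∧ Function.Injective g ∧ (∀ a, 0 < l a) ∧
      (∀ a, c (g a) * s (f a) = b ^ 2 * (l a ^ 2 + s (f a)) ^ 2) ∧
      V = T.submatrix id f * diagonal l * (S.submatrix id g)ᵀ ∧
      U = Z * S.submatrix id g * diagonal (fun a => l a / (l a ^ 2 + s (f a))) *
        (T.submatrix id f)ᵀ := by
  set Q := Uᵀ * U with hQ
  set K := V * Vᵀ + Sig with hK
  have hQt : Qᵀ = Q := by rw [hQ, transpose_mul, transpose_transpose]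
  have hUK : U * K = Z * Vᵀ := by
    rw [hK, Matrix.mul_add, ← Matrix.mul_assoc]
    rw [Matrix.sub_mul] at h1
    rw [← sub_eq_zero, ← h1]; abel
  have hUZ : Q * V + b ^ 2 • V = Uᵀ * Z := by
    rw [Matrix.mul_sub, ← Matrix.mul_assoc] at h2
    rw [← sub_eq_zero, ← h2]; abel
  -- `Uᵀ` times the first equation minus the second times `Vᵀ`: the residual terms cancel. The right
  -- side is symmetric, which forces `Q` and `Sig` to commute.
  have hQS : Q * Sig = b ^ 2 • (V * Vᵀ) := by
    have e1 := congrArg (fun M => Uᵀ * M) h1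
    have e2 := congrArg (fun M => M * Vᵀ) h2
    simp only [Matrix.mul_add, Matrix.add_mul, Matrix.mul_zero, Matrix.zero_mul,
      Matrix.smul_mul, ← Matrix.mul_assoc] at e1 e2
    rw [← sub_eq_zero, hQ]
    rw [← sub_eq_zero, sub_zero, ← e2] at e1
    rw [← sub_eq_zero] at e1
    rw [← e1]; abel
  have hcomm : Q * Sig = Sig * Q := by
    have := congrArg transpose hQS
    rw [transpose_mul, hQt, hSig, transpose_smul, transpose_mul, transpose_transpose] at this
    rw [hQS, this]
  -- Extending the empty family of columns is plain simultaneous diagonalization.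
  obtain ⟨-, T, q, s, hT, -, hTq, hTs⟩ := exists_orthogonal_extension hQt hSig hcomm
    (M := (0 : Matrix (Fin d₁) (Fin 0) ℝ)) (by ext i; exact i.elim0) 0 0
    (by ext i j; exact j.elim0) (by ext i j; exact j.elim0)
  have hs := hpos T s hT hTs
  set p : Fin d₁ → ℝ := fun i => q i * s i / b ^ 2 with hp
  have hVT : V * Vᵀ * T = T * diagonal p := by
    have e : b ^ 2 • (V * Vᵀ * T) = T * diagonal fun i => q i * s i := by
      rw [← Matrix.smul_mul, ← hQS, Matrix.mul_assoc, hTs, ← Matrix.mul_assoc, hTq,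
        Matrix.mul_assoc, diagonal_mul_diagonal]
    ext i j
    have := congrFun (congrFun e i) j
    rw [mul_diagonal] at this ⊢
    rw [Matrix.smul_apply, smul_eq_mul] at this
    rw [hp]
    field_simp
    linarith
  have hKT : K * T = T * diagonal (fun i => p i + s i) := by
    rw [hK, Matrix.add_mul, hVT, hTs, ← Matrix.mul_add, diagonal_add]
  set X := Vᵀ * T with hX
  have hXX : Xᵀ * X = diagonal p := by
    rw [hX, transpose_mul, transpose_transpose, Matrix.mul_assoc, ← Matrix.mul_assoc V, hVT,
      ← Matrix.mul_assoc, orthogonal_transpose_mul hT, Matrix.one_mul]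
  have hsum : ∀ i, ∑ j, X j i ^ 2 = p i := by
    intro i
    have := congrFun (congrFun hXX i) i
    rw [diagonal_apply_eq, Matrix.mul_apply] at this
    simpa [sq] using this
  have hp0 : ∀ i, 0 ≤ p i := fun i => hsum i ▸ Finset.sum_nonneg fun _ _ => sq_nonneg _
  have hXcol : ∀ i, p i = 0 → ∀ j, X j i = 0 := by
    intro i hi j
    have := (Finset.sum_eq_zero_iff_of_nonneg (fun _ _ => sq_nonneg _)).1 ((hsum i).trans hi) j
      (Finset.mem_univ j)
    simpa using this
  -- From `Zᵀ Z Vᵀ = Vᵀ (Q + b²) K`, where both right-hand factors are diagonal in the basis `T`.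
  have hGX : Zᵀ * Z * X = X * diagonal fun i => (q i + b ^ 2) * (p i + s i) := by
    have e1 : Zᵀ * Z * Vᵀ = Vᵀ * (Q + b ^ 2 • 1) * K := by
      have := congrArg transpose hUZ
      rw [transpose_add, transpose_smul, transpose_mul, hQt, transpose_mul,
        transpose_transpose] at this
      rw [Matrix.mul_assoc, ← hUK, ← Matrix.mul_assoc, ← this, Matrix.mul_add Vᵀ, Matrix.mul_smul,
        Matrix.mul_one]
    have e2 : (Q + b ^ 2 • 1) * T = T * diagonal fun i => q i + b ^ 2 := by
      rw [Matrix.add_mul, hTq, Matrix.smul_mul, Matrix.one_mul, ← diagonal_add, Matrix.mul_add]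
      congr 1
      ext i j
      rw [mul_diagonal, Matrix.smul_apply, smul_eq_mul, mul_comm]
    rw [hX, ← Matrix.mul_assoc, e1, Matrix.mul_assoc, hKT, Matrix.mul_assoc,
      ← Matrix.mul_assoc _ T, e2, Matrix.mul_assoc, diagonal_mul_diagonal, Matrix.mul_assoc]
  -- The active latent directions. Their columns of `X` have length `l a = √p` and are normalized to
  -- the orthonormal columns of `B`.
  set A : Finset (Fin d₁) := Finset.univ.filter fun i => p i ≠ 0 with hA
  set f : Fin A.card → Fin d₁ := ⇑(A.orderEmbOfFin rfl) with hf
  have hfinj : Function.Injective f := (A.orderEmbOfFin rfl).injective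
  have hfA : ∀ a, p (f a) ≠ 0 := fun a =>
    (Finset.mem_filter.1 (A.orderEmbOfFin_mem rfl a)).2
  have hfoff : ∀ i, (∀ a, f a ≠ i) → ∀ j, X j i = 0 := by
    intro i hi
    apply hXcol
    by_contra hne
    have : i ∈ Set.range f := by
      rw [hf, Finset.range_orderEmbOfFin]
      simpa [hA] using hne
    obtain ⟨a, ha⟩ := this
    exact hi a ha
  set l : Fin A.card → ℝ := fun a => √(p (f a)) with hl
  have hl0 : ∀ a, 0 < l a := fun a => Real.sqrt_pos.2 (lt_of_le_of_ne (hp0 _) (hfA a).symm)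
  have hl2 : ∀ a, l a ^ 2 = p (f a) := fun a => Real.sq_sqrt (hp0 _)
  set B : Matrix (Fin d₀) (Fin A.card) ℝ := X.submatrix id f * diagonal (fun a => (l a)⁻¹) with hB
  have hBX : B * diagonal l = X.submatrix id f := by
    rw [hB, Matrix.mul_assoc, diagonal_mul_diagonal]
    ext i a
    rw [mul_diagonal, inv_mul_cancel₀ (hl0 a).ne', mul_one]
  have hBB : Bᵀ * B = 1 := by
    have e : (X.submatrix id f)ᵀ * X.submatrix id f = diagonal (p ∘ f) := by
      have : (X.submatrix id f)ᵀ * X.submatrix id f = (Xᵀ * X).submatrix f f := by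
        ext; simp [Matrix.mul_apply]
      rw [this, hXX, submatrix_diagonal _ _ hfinj]
    rw [hB, transpose_mul, diagonal_transpose, Matrix.mul_assoc, ← Matrix.mul_assoc _ (X.submatrix id f),
      e, diagonal_mul_diagonal, diagonal_mul_diagonal, ← diagonal_one]
    congr 1
    ext a
    have := (hl0 a).ne'
    simp only [Function.comp, ← hl2]
    field_simp
  have hGB : Zᵀ * Z * B = B * diagonal fun a => (q (f a) + b ^ 2) * (p (f a) + s (f a)) := by
    have e : Zᵀ * Z * X.submatrix id f =
        X.submatrix id f * diagonal fun a => (q (f a) + b ^ 2) * (p (f a) + s (f a)) := by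
      ext i a
      have := congrFun (congrFun hGX i) (f a)
      rw [mul_diagonal] at this ⊢
      simpa [Matrix.mul_apply] using this
    rw [hB, ← Matrix.mul_assoc, e, Matrix.mul_assoc, Matrix.mul_assoc, diagonal_mul_diagonal,
      diagonal_mul_diagonal]
    simp only [mul_comm]
  have hGt : (Zᵀ * Z)ᵀ = Zᵀ * Z := by rw [transpose_mul, transpose_transpose]
  -- Only one operator is at stake here, so `Zᵀ Z` plays both roles.
  obtain ⟨hr, S, c, -, hS, hSB, hSc, -⟩ :=
    exists_orthogonal_extension hGt hGt rfl B hBB _ _ hGB hGB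
  refine ⟨T, s, S, c, A.card, f, Fin.castLE hr, l, hT, hTs, hS, hSc, hfinj,
    Fin.castLE_injective hr, hl0, fun a => ?_, ?_, ?_⟩
  · have e : c (Fin.castLE hr a) = (q (f a) + b ^ 2) * (p (f a) + s (f a)) := by
      have e1 : B * diagonal (c ∘ Fin.castLE hr) =
          B * diagonal fun a => (q (f a) + b ^ 2) * (p (f a) + s (f a)) := by
        rw [← hGB, ← hSB]
        ext i a
        have := congrFun (congrFun hSc i) (Fin.castLE hr a)
        rw [mul_diagonal] at this ⊢
        simpa [Matrix.mul_apply] using this.symm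
      have e2 := congrArg (fun M => Bᵀ * M) e1
      simp only [← Matrix.mul_assoc, hBB, Matrix.one_mul] at e2
      exact congrFun (diagonal_injective e2) a
    rw [e, hl2]
    have hs' := (hs (f a)).ne'
    have hb' := hb.ne'
    have : q (f a) * s (f a) = p (f a) * b ^ 2 := by
      simp only [hp]; field_simp
    linear_combination (p (f a) + s (f a)) * this
  · have e : Vᵀ = X * diagonal (fun _ : Fin d₁ => (1 : ℝ)) * Tᵀ := by
      rw [diagonal_one, Matrix.mul_one, hX, Matrix.mul_assoc, orthogonal_mul_transpose hT,
        Matrix.mul_one]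
    rw [mul_diagonal_mul_transpose_restrict X T _ hfinj hfoff, ← hBX] at e
    have e2 := congrArg transpose e
    rw [transpose_transpose] at e2
    rw [e2, hSB]
    simp [Function.comp_def, Matrix.mul_assoc]
  -- The first stationarity equation reads `U K = Z Vᵀ`, and `K` is invertible with eigenvalues `p i
  -- + s i > 0`.
  · have e : U = Z * (X * diagonal (fun i => (p i + s i)⁻¹) * Tᵀ) := by
      have e1 : U * T * diagonal (fun i => p i + s i) = Z * X := by
        rw [Matrix.mul_assoc, ← hKT, ← Matrix.mul_assoc, hUK, Matrix.mul_assoc]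
      have e2 : diagonal (fun i => p i + s i) * diagonal (fun i => (p i + s i)⁻¹) = 1 := by
        rw [diagonal_mul_diagonal, ← diagonal_one]
        congr 1
        ext i
        exact mul_inv_cancel₀ (by have := hs i; have := hp0 i; positivity)
      rw [← Matrix.mul_assoc, ← Matrix.mul_assoc, ← e1, Matrix.mul_assoc (U * T), e2,
        Matrix.mul_one, Matrix.mul_assoc, orthogonal_mul_transpose hT, Matrix.mul_one]
    rw [mul_diagonal_mul_transpose_restrict X T _ hfinj hfoff, ← hBX, Matrix.mul_assoc B,
      diagonal_mul_diagonal, ← hSB] at e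
    rw [e]
    simp only [hl2, Function.comp_def, Matrix.mul_assoc, div_eq_mul_inv]

end Structure

/-! ### Optimal partial matchings. -/

section Exchange

theorem sq_max_zero_lt {x y : ℝ} (hxy : x < y) (hy : 0 < y) : max 0 x ^ 2 < max 0 y ^ 2 := by
  rw [max_eq_right hy.le]
  exact pow_lt_pow_left₀ (max_lt hy hxy) (le_max_left _ _) two_ne_zero

/-- Pairing the larger `θ'` with the smaller `t` gains `2 (θ' - θ) (t' - t)` when all four
differences are nonnegative; truncation at zero keeps the gain strict. -/
theorem sq_max_zero_exchange {θ θ' t t' : ℝ} (hθ : θ < θ') (ht : t < t') (h : t < θ)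
    (h' : t' < θ') :
    max 0 (θ - t) ^ 2 + max 0 (θ' - t') ^ 2 < max 0 (θ' - t) ^ 2 + max 0 (θ - t') ^ 2 := by
  rw [max_eq_right (by linarith : (0 : ℝ) ≤ θ - t), max_eq_right (by linarith : (0 : ℝ) ≤ θ' - t'),
    max_eq_right (by linarith : (0 : ℝ) ≤ θ' - t)]
  rcases le_total t' θ with h0 | h0
  · rw [max_eq_right (by linarith)]
    nlinarith [mul_pos (sub_pos.2 hθ) (sub_pos.2 ht)]
  · rw [max_eq_left (by linarith)]
    nlinarith [mul_pos (sub_pos.2 hθ) (sub_pos.2 ht), mul_pos (sub_pos.2 h) (sub_pos.2 h'),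
      mul_nonneg (sub_nonneg.2 h0) (sub_pos.2 h').le, mul_nonneg (sub_nonneg.2 h0) (sub_pos.2 h).le,
      sq_nonneg (t' - θ)]

variable {m n r : ℕ} {t : Fin m → ℝ} {θ : Fin n → ℝ} {f : Fin r → Fin m} {g : Fin r → Fin n}

/-- The gain of the partial matching `f a ↔ g a`. -/
noncomputable def matchingGain (t : Fin m → ℝ) (θ : Fin n → ℝ) (f : Fin r → Fin m)
    (g : Fin r → Fin n) : ℝ :=
  ∑ a, max 0 (θ (g a) - t (f a)) ^ 2

/-- An optimal matching with positive gains can be sorted. -/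
theorem exists_sorted_of_optimal_matching (hf : Function.Injective f) (hg : Function.Injective g)
    (hact : ∀ a, t (f a) < θ (g a))
    (hopt : ∀ (k : ℕ) (f' : Fin k → Fin m) (g' : Fin k → Fin n), Function.Injective f' →
      Function.Injective g' → matchingGain t θ f' g' ≤ matchingGain t θ f g) :
    ∃ (hm : r ≤ m) (hn : r ≤ n) (ρ : Equiv.Perm (Fin r)) (e : Equiv.Perm (Fin m))
      (e' : Equiv.Perm (Fin n)), (∀ a, e (Fin.castLE hm a) = f (ρ a)) ∧
      (∀ a, e' (Fin.castLE hn a) = g (ρ a)) ∧ Monotone (t ∘ e) ∧ Antitone (θ ∘ e') ∧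
      ∀ (i : Fin m) (j : Fin n), (i : ℕ) = j → r ≤ (i : ℕ) → θ (e' j) ≤ t (e i) := by
  -- Otherwise re-matching to the unused `k` would strictly raise the gain.
  have hf_le : ∀ k, (∀ a, f a ≠ k) → ∀ a, t (f a) ≤ t k := by
    intro k hk a
    by_contra! hlt
    refine absurd (hopt r (Function.update f a k) g ?_ hg) (not_le.2 ?_)
    · intro x y hxy
      by_contra hne
      simp only [Function.update_apply] at hxy
      split_ifs at hxy with h1 h2 h2
      · exact hne (h1.trans h2.symm)
      · exact hk _ hxy.symm
      · exact hk _ hxy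
      · exact hne (hf hxy)
    · refine Finset.sum_lt_sum (fun x _ => ?_) ⟨a, Finset.mem_univ a, ?_⟩
      · rcases eq_or_ne x a with rfl | hx
        · rw [Function.update_self]
          exact (sq_max_zero_lt (by linarith) (by linarith [hact x])).le
        · rw [Function.update_of_ne hx]
      · rw [Function.update_self]
        exact sq_max_zero_lt (by linarith) (by linarith [hact a])
  have hg_le : ∀ k, (∀ a, g a ≠ k) → ∀ a, θ k ≤ θ (g a) := by
    intro k hk a
    by_contra! hlt
    refine absurd (hopt r f (Function.update g a k) hf ?_) (not_le.2 ?_)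
    · intro x y hxy
      by_contra hne
      simp only [Function.update_apply] at hxy
      split_ifs at hxy with h1 h2 h2
      · exact hne (h1.trans h2.symm)
      · exact hk _ hxy.symm
      · exact hk _ hxy
      · exact hne (hg hxy)
    · refine Finset.sum_lt_sum (fun x _ => ?_) ⟨a, Finset.mem_univ a, ?_⟩
      · rcases eq_or_ne x a with rfl | hx
        · rw [Function.update_self]
          exact (sq_max_zero_lt (by linarith) (by linarith [hact x])).le
        · rw [Function.update_of_ne hx]
      · rw [Function.update_self]
        exact sq_max_zero_lt (by linarith) (by linarith [hact a])
  have hswap : ∀ a a', t (f a) < t (f a') → θ (g a') ≤ θ (g a) := by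
    intro a a' ht
    by_contra! hθ
    have hne : a ≠ a' := by rintro rfl; exact lt_irrefl _ ht
    refine absurd (hopt r (f ∘ Equiv.swap a a') g (hf.comp (Equiv.injective _)) hg) (not_le.2 ?_)
    rw [← sub_pos, matchingGain, matchingGain, ← Finset.sum_sub_distrib,
      Fintype.sum_eq_add a a' hne]
    · simp only [Function.comp, Equiv.swap_apply_left, Equiv.swap_apply_right]
      have := sq_max_zero_exchange hθ ht (hact a) (hact a')
      linarith
    · rintro x ⟨hx, hx'⟩
      simp only [Function.comp, Equiv.swap_apply_of_ne_of_ne hx hx', sub_self]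
  -- The second key breaks ties: the swap argument says nothing about equal `t`, where pairs are
  -- ordered by decreasing `θ`.
  set ρ := Tuple.sort fun a => toLex (t (f a), -θ (g a)) with hρ
  have hmono := Tuple.monotone_sort fun a => toLex (t (f a), -θ (g a))
  rw [← hρ] at hmono
  have hlex : ∀ a b, a ≤ b → t (f (ρ a)) < t (f (ρ b)) ∨
      t (f (ρ a)) = t (f (ρ b)) ∧ θ (g (ρ b)) ≤ θ (g (ρ a)) := by
    intro a b hab
    have := Prod.Lex.toLex_le_toLex.1 (hmono hab)
    simpa using this
  obtain ⟨hm, e, he, hem⟩ := exists_sorting_extension t (f ∘ ρ) (hf.comp ρ.injective)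
    (fun a b hab => by
      rcases hlex a b hab with h | h
      · exact h.le
      · exact h.1.le)
    (fun k hk a => hf_le k (fun x => by simpa using hk (ρ.symm x)) (ρ a))
  obtain ⟨hn, e', he', hem'⟩ := exists_sorting_extension (fun j => -θ j) (g ∘ ρ)
    (hg.comp ρ.injective)
    (fun a b hab => by
      rcases hlex a b hab with h | h
      · exact neg_le_neg (hswap _ _ h)
      · exact neg_le_neg h.2)
    (fun k hk a => neg_le_neg (hg_le k (fun x => by simpa using hk (ρ.symm x)) (ρ a)))
  refine ⟨hm, hn, ρ, e, e', he, he', hem, fun a b hab => by simpa using hem' hab, ?_⟩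
  intro i j hij hri
  by_contra! hlt
  have hfi : ∀ a, f a ≠ e i := by
    intro a ha
    have := he (ρ.symm a)
    rw [Function.comp, Equiv.apply_symm_apply, ha] at this
    have := congrArg Fin.val (e.injective this)
    have h2 := (ρ.symm a).2
    simp at this
    omega
  have hgj : ∀ a, g a ≠ e' j := by
    intro a ha
    have := he' (ρ.symm a)
    rw [Function.comp, Equiv.apply_symm_apply, ha] at this
    have := congrArg Fin.val (e'.injective this)
    have h2 := (ρ.symm a).2
    simp at this
    omega
  -- A profitable pair beyond the matched ones could be added; hence optimality is required against
  -- matchings of every size.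
  refine absurd (hopt (r + 1) (Fin.snoc f (e i) : Fin (r + 1) → Fin m)
    (Fin.snoc g (e' j) : Fin (r + 1) → Fin n)
    (Fin.snoc_injective_of_injective hf fun ⟨a, ha⟩ => hfi a ha)
    (Fin.snoc_injective_of_injective hg fun ⟨a, ha⟩ => hgj a ha)) (not_le.2 ?_)
  rw [matchingGain, matchingGain, Fin.sum_univ_castSucc]
  simp only [Fin.snoc_castSucc, Fin.snoc_last]
  rw [max_eq_right (by linarith : (0 : ℝ) ≤ θ (e' j) - t (e i))]
  have : 0 < (θ (e' j) - t (e i)) ^ 2 := pow_pos (by linarith) 2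
  linarith

end Exchange

/-! ### The objective on diagonal pairs and its invariance. -/

section Values

variable {D₀ d₀ d₁ r : ℕ}

theorem frobSq_mul_transpose_of_orthonormal {m n : ℕ} (X : Matrix (Fin m) (Fin r) ℝ)
    {B : Matrix (Fin n) (Fin r) ℝ} (hB : Bᵀ * B = 1) : frobSq (X * Bᵀ) = frobSq X := by
  rw [frobSq_eq_trace, frobSq_eq_trace, transpose_mul, transpose_transpose, Matrix.mul_assoc,
    trace_mul_comm, Matrix.mul_assoc, Matrix.mul_assoc, hB, Matrix.mul_one]

theorem frobSq_mul_of_orthonormal {m n : ℕ} (X : Matrix (Fin r) (Fin m) ℝ)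
    {B : Matrix (Fin n) (Fin r) ℝ} (hB : Bᵀ * B = 1) : frobSq (B * X) = frobSq X := by
  rw [frobSq_eq_trace, frobSq_eq_trace, transpose_mul, Matrix.mul_assoc, ← Matrix.mul_assoc Bᵀ,
    hB, Matrix.one_mul]

/-- In joint eigenbases the objective decouples into scalar terms. Writing `U` through `Z * B`
avoids left singular vectors, so `w` is a decoder entry divided by its singular value. -/
theorem objective_of_orthonormal (b : ℝ) (Z : Matrix (Fin D₀) (Fin d₀) ℝ)
    (Sig : Matrix (Fin d₁) (Fin d₁) ℝ) {A : Matrix (Fin d₁) (Fin r) ℝ}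
    {B : Matrix (Fin d₀) (Fin r) ℝ} (hA : Aᵀ * A = 1) (hB : Bᵀ * B = 1) {s c : Fin r → ℝ}
    (hAS : Sig * A = A * diagonal s) (hBZ : Zᵀ * Z * B = B * diagonal c) (l w : Fin r → ℝ) :
    objective b Z Sig (Z * B * diagonal w * Aᵀ) (A * diagonal l * Bᵀ) =
      frobSq Z + b ^ 2 * trace Sig +
        ∑ a, (c a * ((w a * l a - 1) ^ 2 - 1 + w a ^ 2 * s a) + b ^ 2 * l a ^ 2) := by
  have hC : Bᵀ * (Zᵀ * Z) * B = diagonal c := by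
    rw [Matrix.mul_assoc, hBZ, ← Matrix.mul_assoc, hB, Matrix.one_mul]
  have hD : ∀ x : Fin r → ℝ, frobSq (Z * B * diagonal x) = ∑ a, c a * x a ^ 2 := by
    intro x
    have : (Z * B * diagonal x)ᵀ * (Z * B * diagonal x) =
        diagonal x * (Bᵀ * (Zᵀ * Z) * B) * diagonal x := by
      simp only [transpose_mul, diagonal_transpose, Matrix.mul_assoc]
    rw [frobSq_eq_trace, this, hC, diagonal_mul_diagonal, diagonal_mul_diagonal, trace_diagonal]
    exact Finset.sum_congr rfl fun a _ => by ring
  have hUV : Z * B * diagonal w * Aᵀ * (A * diagonal l * Bᵀ) =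
      Z * B * diagonal (fun a => w a * l a) * Bᵀ := by
    rw [← diagonal_mul_diagonal]
    simp only [Matrix.mul_assoc]
    rw [← Matrix.mul_assoc Aᵀ, hA, Matrix.one_mul]
  have h1 : frobSq (Z * B * diagonal w * Aᵀ * (A * diagonal l * Bᵀ) - Z) =
      ∑ a, c a * (w a * l a) ^ 2 - 2 * ∑ a, c a * (w a * l a) + frobSq Z := by
    have : trace ((Z * B * diagonal (fun a => w a * l a) * Bᵀ)ᵀ * Z) =
        ∑ a, c a * (w a * l a) := by
      rw [transpose_mul, transpose_mul, transpose_mul, transpose_transpose, diagonal_transpose,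
        Matrix.mul_assoc, trace_mul_comm, Matrix.mul_assoc, Matrix.mul_assoc, Matrix.mul_assoc,
        ← Matrix.mul_assoc Zᵀ, ← Matrix.mul_assoc Bᵀ, hC, diagonal_mul_diagonal, trace_diagonal]
      exact Finset.sum_congr rfl fun a _ => by ring
    rw [hUV, sub_eq_add_neg, ← neg_one_smul ℝ Z, frobSq_add_smul, this,
      frobSq_mul_transpose_of_orthonormal _ hB, hD]
    ring
  have h2 : trace ((Z * B * diagonal w * Aᵀ)ᵀ * (Z * B * diagonal w * Aᵀ) * Sig) =
      ∑ a, c a * (w a ^ 2 * s a) := by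
    have hE : Aᵀ * Sig * A = diagonal s := by
      rw [Matrix.mul_assoc, hAS, ← Matrix.mul_assoc, hA, Matrix.one_mul]
    have : (Z * B * diagonal w * Aᵀ)ᵀ * (Z * B * diagonal w * Aᵀ) * Sig =
        A * (diagonal w * (Bᵀ * (Zᵀ * Z) * B) * diagonal w * Aᵀ * Sig) := by
      simp only [transpose_mul, transpose_transpose, diagonal_transpose, Matrix.mul_assoc]
    rw [this, trace_mul_comm, Matrix.mul_assoc _ Aᵀ, Matrix.mul_assoc _ (Aᵀ * Sig), hE, hC,
      diagonal_mul_diagonal, diagonal_mul_diagonal, diagonal_mul_diagonal, trace_diagonal]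
    exact Finset.sum_congr rfl fun a _ => by ring
  have h3 : frobSq (A * diagonal l * Bᵀ) = ∑ a, l a ^ 2 := by
    rw [frobSq_mul_transpose_of_orthonormal _ hB, frobSq_mul_of_orthonormal _ hA, frobSq_eq_trace,
      diagonal_transpose, diagonal_mul_diagonal, trace_diagonal]
    exact Finset.sum_congr rfl fun a _ => by ring
  rw [objective, h1, Matrix.add_mul, trace_add, h2, h3, Matrix.smul_mul, trace_smul,
    Matrix.one_mul, smul_eq_mul, Finset.mul_sum, Finset.mul_sum]
  simp only [sub_eq_add_neg, ← Finset.sum_neg_distrib]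
  have : ∑ a, (c a * ((w a * l a + -1) ^ 2 + -1 + w a ^ 2 * s a) + b ^ 2 * l a ^ 2) =
      ∑ a, c a * (w a * l a) ^ 2 + ∑ a, -(2 * (c a * (w a * l a))) + ∑ a, c a * (w a ^ 2 * s a) +
        ∑ a, b ^ 2 * l a ^ 2 := by
    simp only [← Finset.sum_add_distrib]
    exact Finset.sum_congr rfl fun a _ => by ring
  rw [this]
  ring

theorem objective_orthogonal_conj (b : ℝ) {R : Matrix (Fin D₀) (Fin D₀) ℝ}
    {S : Matrix (Fin d₀) (Fin d₀) ℝ} {T : Matrix (Fin d₁) (Fin d₁) ℝ}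
    (hR : R ∈ orthogonalGroup (Fin D₀) ℝ) (hS : S ∈ orthogonalGroup (Fin d₀) ℝ)
    (hT : T ∈ orthogonalGroup (Fin d₁) ℝ) (Z : Matrix (Fin D₀) (Fin d₀) ℝ)
    (Sig : Matrix (Fin d₁) (Fin d₁) ℝ) (U : Matrix (Fin D₀) (Fin d₁) ℝ)
    (V : Matrix (Fin d₁) (Fin d₀) ℝ) :
    objective b (R * Z * Sᵀ) (T * Sig * Tᵀ) (R * U * Tᵀ) (T * V * Sᵀ) = objective b Z Sig U V := by
  have hRR := orthogonal_transpose_mul hR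
  have hSS := orthogonal_transpose_mul hS
  have hTT := orthogonal_transpose_mul hT
  have h1 : R * U * Tᵀ * (T * V * Sᵀ) - R * Z * Sᵀ = R * (U * V - Z) * Sᵀ := by
    rw [Matrix.mul_sub, Matrix.sub_mul]
    simp only [Matrix.mul_assoc]
    rw [← Matrix.mul_assoc Tᵀ, hTT, Matrix.one_mul]
  have h2 : ((R * U * Tᵀ)ᵀ * (R * U * Tᵀ) + b ^ 2 • (1 : Matrix (Fin d₁) (Fin d₁) ℝ)) =
      T * (Uᵀ * U + b ^ 2 • 1) * Tᵀ := by
    rw [Matrix.mul_add, Matrix.add_mul, Matrix.mul_smul, Matrix.mul_one, Matrix.smul_mul,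
      orthogonal_mul_transpose hT]
    simp only [transpose_mul, transpose_transpose, Matrix.mul_assoc]
    rw [← Matrix.mul_assoc Rᵀ, hRR, Matrix.one_mul]
  have h3 : trace (T * (Uᵀ * U + b ^ 2 • 1) * Tᵀ * (T * Sig * Tᵀ)) =
      trace ((Uᵀ * U + b ^ 2 • 1) * Sig) := by
    simp only [Matrix.mul_assoc]
    rw [← Matrix.mul_assoc Tᵀ, hTT, Matrix.one_mul, trace_mul_comm]
    simp only [Matrix.mul_assoc]
    rw [hTT, Matrix.mul_one]
  rw [objective, objective, h1, h2, h3, frobSq_mul_transpose_of_orthonormal _ hSS,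
    frobSq_mul_of_orthonormal _ hRR, frobSq_mul_transpose_of_orthonormal _ hSS,
    frobSq_mul_of_orthonormal _ hTT]

end Values

/-! ### The scalar problem for one matched pair. -/

section OptimalEntries

/-- The optimal encoder singular value for a singular value `θ` and a standard deviation `τ`. -/
noncomputable def encEntry (b τ θ : ℝ) : ℝ := √(max 0 (τ / b * (θ - b * τ)))

/-- The optimal decoder singular value for a singular value `θ` and a standard deviation `τ`. -/
noncomputable def decEntry (b τ θ : ℝ) : ℝ := √(max 0 (b / τ * (θ - b * τ)))

variable {b τ θ : ℝ}

theorem decEntry_eq (hb : 0 < b) (hτ : 0 < τ) : decEntry b τ θ = b / τ * encEntry b τ θ := by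
  have h : max 0 (b / τ * (θ - b * τ)) = (b / τ) ^ 2 * max 0 (τ / b * (θ - b * τ)) := by
    rw [mul_max_of_nonneg _ _ (sq_nonneg _), mul_zero]
    congr 1
    field_simp
  rw [decEntry, encEntry, h, Real.sqrt_mul (sq_nonneg _), Real.sqrt_sq (by positivity)]

theorem encEntry_eq_zero (hb : 0 < b) (hτ : 0 < τ) (h : θ ≤ b * τ) : encEntry b τ θ = 0 := by
  rw [encEntry, max_eq_left, Real.sqrt_zero]
  exact mul_nonpos_of_nonneg_of_nonpos (by positivity) (by linarith)

theorem encEntry_pos (hb : 0 < b) (hτ : 0 < τ) (h : b * τ < θ) : 0 < encEntry b τ θ := by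
  rw [encEntry, Real.sqrt_pos]
  exact lt_max_of_lt_right (mul_pos (by positivity) (by linarith))

/-- This turns minimizing the loss over matchings into maximizing `matchingGain` with thresholds `t
= bτ`. -/
theorem encEntry_gain (hb : 0 < b) (hτ : 0 < τ) (hθ : 0 < θ) :
    θ ^ 2 * ((decEntry b τ θ / θ * encEntry b τ θ - 1) ^ 2 - 1 + (decEntry b τ θ / θ) ^ 2 * τ ^ 2) +
      b ^ 2 * encEntry b τ θ ^ 2 = -max 0 (θ - b * τ) ^ 2 := by
  rw [decEntry_eq hb hτ]
  rcases le_total θ (b * τ) with h | h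
  · rw [encEntry_eq_zero hb hτ h, max_eq_left (by linarith)]
    simp
  · have hsq : encEntry b τ θ ^ 2 = τ / b * (θ - b * τ) := by
      have h0 : 0 ≤ τ / b * (θ - b * τ) := mul_nonneg (by positivity) (by linarith)
      rw [encEntry, max_eq_right h0, Real.sq_sqrt h0]
    rw [max_eq_right (by linarith)]
    have h1 : b / τ * encEntry b τ θ / θ * encEntry b τ θ = b / τ / θ * encEntry b τ θ ^ 2 := by
      ring
    have h2 : (b / τ * encEntry b τ θ / θ) ^ 2 = (b / τ / θ) ^ 2 * encEntry b τ θ ^ 2 := by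
      ring
    rw [h1, h2, hsq]
    field_simp
    ring

/-- The stationarity relation determines the encoder entry. -/
theorem eq_encEntry_of_relation (hb : 0 < b) (hτ : 0 < τ) (hθ : 0 < θ) {l : ℝ} (hl : 0 < l)
    (h : θ ^ 2 * τ ^ 2 = b ^ 2 * (l ^ 2 + τ ^ 2) ^ 2) :
    b * τ < θ ∧ l = encEntry b τ θ ∧ l / (l ^ 2 + τ ^ 2) = decEntry b τ θ / θ := by
  -- Positivity selects the positive square root of the relation.
  have h1 : θ * τ = b * (l ^ 2 + τ ^ 2) := by
    have : (θ * τ) ^ 2 = (b * (l ^ 2 + τ ^ 2)) ^ 2 := by linear_combination h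
    exact (pow_left_inj₀ (by positivity) (by positivity) two_ne_zero).1 this
  have h2 : l ^ 2 = τ / b * (θ - b * τ) := by
    field_simp
    linear_combination -h1
  have h3 : b * τ < θ := by
    have : 0 < τ / b * (θ - b * τ) := h2 ▸ pow_pos hl 2
    have := (pos_iff_pos_of_mul_pos this).1 (by positivity)
    linarith
  have h4 : l = encEntry b τ θ := by
    rw [encEntry, max_eq_right (h2 ▸ sq_nonneg l), ← h2, Real.sqrt_sq hl.le]
  refine ⟨h3, h4, ?_⟩
  rw [decEntry_eq hb hτ, ← h4]
  field_simp
  linear_combination h1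

end OptimalEntries

/-! ### Rectangular diagonal matrices. -/

section RectDiag

variable {m n k : ℕ}

theorem mul_rectDiag_apply (X : Matrix (Fin k) (Fin m) ℝ) (w : Fin n → ℝ) (i : Fin k) (j : Fin n) :
    (X * rectDiag m w) i j = if h : (j : ℕ) < m then X i ⟨j, h⟩ * w j else 0 := by
  rw [Matrix.mul_apply]
  simp only [rectDiag, Matrix.of_apply]
  split_ifs with h
  · rw [Finset.sum_eq_single ⟨j, h⟩]
    · simp
    · intro x _ hx
      rw [if_neg (fun he => hx (Fin.ext he)), mul_zero]
    · simp
  · refine Finset.sum_eq_zero fun x _ => ?_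
    rw [if_neg (by have := x.2; omega), mul_zero]

theorem mul_rectDiag_mul_transpose_restrict {r p q : ℕ} (hm : r ≤ m) (hn : r ≤ n)
    (X : Matrix (Fin p) (Fin m) ℝ) (Y : Matrix (Fin q) (Fin n) ℝ) (w : Fin n → ℝ)
    (hw : ∀ i : Fin n, r ≤ (i : ℕ) → w i = 0) :
    X * rectDiag m w * Yᵀ = X.submatrix id (Fin.castLE hm) * diagonal (w ∘ Fin.castLE hn) *
      (Y.submatrix id (Fin.castLE hn))ᵀ := by
  have h := mul_diagonal_mul_transpose_restrict (X * rectDiag m w) Y (fun _ => 1)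
    (Fin.castLE_injective hn) (by
      intro i hi j
      have h0 : w i = 0 := hw i (by
        by_contra! hlt
        exact hi ⟨i, hlt⟩ rfl)
      simp [mul_rectDiag_apply, h0])
  rw [diagonal_one, Matrix.mul_one] at h
  rw [h]
  congr 1
  ext i a
  have : ((Fin.castLE hn a : Fin n) : ℕ) < m := by
    have := a.2
    simp only [Fin.val_castLE]
    omega
  rw [mul_diagonal, mul_diagonal, submatrix_apply, mul_rectDiag_apply, dif_pos this]
  simp [Fin.castLE]

theorem rectDiag_mul_rectDiag (v : Fin n → ℝ) (w : Fin k → ℝ) (u : Fin k → ℝ)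
    (hu : ∀ (i : Fin k) (j : Fin n), (i : ℕ) = j → v j * w i = u i)
    (hu0 : ∀ i : Fin k, n ≤ (i : ℕ) → u i = 0) :
    rectDiag m v * rectDiag n w = rectDiag m u := by
  ext i j
  rw [mul_rectDiag_apply]
  simp only [rectDiag, Matrix.of_apply]
  split_ifs with h1 h2 h2
  · exact hu j ⟨j, h1⟩ rfl
  · rw [zero_mul]
  · rw [hu0 j (by omega)]
  · rfl

end RectDiag

/-! ### Characterization of the minimizers. -/

section Minimizers

variable {D₀ d₀ d₁ : ℕ}

theorem sorted_pos {σ : Fin d₁ → ℝ} (hσ : ∀ i, 0 < σ i) (i : Fin d₁) : 0 < sorted σ i := hσ _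

theorem encVar_transpose (σ : Fin d₁ → ℝ) : (encVar σ)ᵀ = encVar σ := diagonal_transpose _

theorem submatrix_orthonormal {n r : ℕ} {T : Matrix (Fin n) (Fin n) ℝ}
    (hT : T ∈ orthogonalGroup (Fin n) ℝ) {f : Fin r → Fin n} (hf : Function.Injective f) :
    (T.submatrix id f)ᵀ * T.submatrix id f = 1 := by
  have h : (T.submatrix id f)ᵀ * T.submatrix id f = (Tᵀ * T).submatrix f f := by
    ext; simp [Matrix.mul_apply]
  rw [h, orthogonal_transpose_mul hT, submatrix_one _ hf]

theorem mul_submatrix_of_diagonalizes {n r : ℕ} {A T : Matrix (Fin n) (Fin n) ℝ} {a : Fin n → ℝ}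
    (h : A * T = T * diagonal a) (f : Fin r → Fin n) :
    A * T.submatrix id f = T.submatrix id f * diagonal (a ∘ f) := by
  ext i j
  have := congrFun (congrFun h i) (f j)
  rw [mul_diagonal] at this ⊢
  simpa [Matrix.mul_apply] using this

/-- A matrix with positive singular values has an SVD with any prescribed sorted eigenbasis of
`Zᵀ Z` as right singular vectors. -/
theorem exists_isSVD {Z : Matrix (Fin D₀) (Fin d₀) ℝ} {S : Matrix (Fin d₀) (Fin d₀) ℝ}
    (hS : S ∈ orthogonalGroup (Fin d₀) ℝ)
    (h : Zᵀ * Z * S = S * diagonal fun j : Fin d₀ => singVal Z j ^ 2)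
    (hpos : ∀ j : Fin d₀, 0 < singVal Z j) :
    ∃ R, IsSVD Z R S := by
  set N := Z * S * diagonal fun j : Fin d₀ => (singVal Z j)⁻¹ with hN
  have hNN : Nᵀ * N = 1 := by
    have e : Nᵀ * N = diagonal (fun j : Fin d₀ => (singVal Z j)⁻¹) * (Sᵀ * (Zᵀ * Z * S)) *
        diagonal fun j : Fin d₀ => (singVal Z j)⁻¹ := by
      simp only [hN, transpose_mul, diagonal_transpose, Matrix.mul_assoc]
    rw [e, h, ← Matrix.mul_assoc Sᵀ, orthogonal_transpose_mul hS, Matrix.one_mul,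
      diagonal_mul_diagonal, diagonal_mul_diagonal, ← diagonal_one]
    congr 1
    ext j
    have := (hpos j).ne'
    field_simp
  obtain ⟨hle, R, -, -, hR, hRN, -, -⟩ := exists_orthogonal_extension
    (A := (0 : Matrix (Fin D₀) (Fin D₀) ℝ)) (B := 0) (by simp) (by simp) rfl N hNN 0 0
    (by ext; simp) (by ext; simp)
  refine ⟨R, hR, hS, ?_⟩
  have e : R * rectDiag D₀ (fun j : Fin d₀ => singVal Z j) = Z * S := by
    ext i j
    rw [mul_rectDiag_apply, dif_pos (lt_of_lt_of_le j.2 hle)]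
    have := congrFun (congrFun hRN i) j
    rw [hN, mul_diagonal, submatrix_apply] at this
    have h2 := (hpos j).ne'
    change R i (Fin.castLE hle j) * _ = _
    rw [id] at this
    rw [this]
    field_simp
  rw [e, Matrix.mul_assoc, orthogonal_mul_transpose hS, Matrix.mul_one]

theorem canonical_of_minimizer {b : ℝ} (hb : 0 < b) {Z : Matrix (Fin D₀) (Fin d₀) ℝ}
    (hZ : ∀ (S : Matrix (Fin d₀) (Fin d₀) ℝ) (c : Fin d₀ → ℝ), S ∈ orthogonalGroup (Fin d₀) ℝ →
      Zᵀ * Z * S = S * diagonal c → ∀ j, 0 < c j)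
    {σ : Fin d₁ → ℝ} (hσ : ∀ i, 0 < σ i) {U : Matrix (Fin D₀) (Fin d₁) ℝ}
    {V : Matrix (Fin d₁) (Fin d₀) ℝ}
    (hmin : ∀ U' V', objective b Z (encVar σ) U V ≤ objective b Z (encVar σ) U' V') :
    ∃ (R : Matrix (Fin D₀) (Fin D₀) ℝ) (S : Matrix (Fin d₀) (Fin d₀) ℝ)
      (T : Matrix (Fin d₁) (Fin d₁) ℝ), IsSVD Z R S ∧ IsSorting σ T ∧
      U = R * rectDiag D₀ (fun i : Fin d₁ => decEntry b (sorted σ i) (singVal Z i)) * Tᵀ ∧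
      V = T * (rectDiag d₀ (fun i : Fin d₁ => encEntry b (sorted σ i) (singVal Z i)))ᵀ * Sᵀ := by
  have hperm : ∀ (T : Matrix (Fin d₁) (Fin d₁) ℝ) (s : Fin d₁ → ℝ),
      T ∈ orthogonalGroup (Fin d₁) ℝ → encVar σ * T = T * diagonal s →
      ∃ e : Equiv.Perm (Fin d₁), s = (fun i => σ i ^ 2) ∘ e := fun T s hT h =>
    exists_perm_of_diagonalizations hT h
  obtain ⟨T, s, S, c, r, f, g, l, hT, hTs, hS, hSc, hf, hg, hl, hrel, hV, hU⟩ :=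
    exists_eigenbases_of_stationary hb (encVar_transpose σ) (fun T s hT h i => by
        obtain ⟨e, rfl⟩ := hperm T s hT h
        exact pow_pos (hσ _) 2)
      (stationary_left (encVar_transpose σ) hmin) (stationary_right hmin)
  have hs0 : ∀ i, 0 < s i := fun i => by
    obtain ⟨e, rfl⟩ := hperm T s hT hTs
    exact pow_pos (hσ _) 2
  have hc0 := hZ S c hS hSc
  obtain ⟨τ, hτ, hτs⟩ : ∃ τ : Fin d₁ → ℝ, (∀ i, 0 < τ i) ∧ ∀ i, s i = τ i ^ 2 :=
    ⟨fun i => √(s i), fun i => Real.sqrt_pos.2 (hs0 i), fun i => (Real.sq_sqrt (hs0 i).le).symm⟩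
  obtain ⟨θ, hθ, hθc⟩ : ∃ θ : Fin d₀ → ℝ, (∀ i, 0 < θ i) ∧ ∀ i, c i = θ i ^ 2 :=
    ⟨fun i => √(c i), fun i => Real.sqrt_pos.2 (hc0 i), fun i => (Real.sq_sqrt (hc0 i).le).symm⟩
  have hent := fun a => eq_encEntry_of_relation hb (hτ (f a)) (hθ (g a)) (hl a)
    (by rw [← hτs, ← hθc]; exact hrel a)
  -- The bases `T` and `S` of the minimizer stay fixed while the matching varies; these are the
  -- competitors that make its own matching optimal.
  have hvalue : ∀ (k : ℕ) (f' : Fin k → Fin d₁) (g' : Fin k → Fin d₀), Function.Injective f' →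
      Function.Injective g' →
      objective b Z (encVar σ)
        (Z * S.submatrix id g' *
          diagonal (fun a => decEntry b (τ (f' a)) (θ (g' a)) / θ (g' a)) * (T.submatrix id f')ᵀ)
        (T.submatrix id f' * diagonal (fun a => encEntry b (τ (f' a)) (θ (g' a))) *
          (S.submatrix id g')ᵀ) =
        frobSq Z + b ^ 2 * trace (encVar σ) - matchingGain (fun i => b * τ i) θ f' g' := by
    intro k f' g' hf' hg'
    rw [objective_of_orthonormal b Z (encVar σ) (submatrix_orthonormal hT hf')
      (submatrix_orthonormal hS hg') (mul_submatrix_of_diagonalizes hTs f')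
      (mul_submatrix_of_diagonalizes hSc g'), matchingGain, sub_eq_add_neg,
      ← Finset.sum_neg_distrib]
    congr 1
    refine Finset.sum_congr rfl fun a _ => ?_
    simp only [Function.comp, hτs, hθc]
    exact encEntry_gain hb (hτ _) (hθ _)
  have hl' : l = fun a => encEntry b (τ (f a)) (θ (g a)) := funext fun a => (hent a).2.1
  have hw' : (fun a => l a / (l a ^ 2 + s (f a))) =
      fun a => decEntry b (τ (f a)) (θ (g a)) / θ (g a) :=
    funext fun a => by rw [hτs]; exact (hent a).2.2
  rw [hw'] at hU
  rw [hl'] at hV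
  obtain ⟨h₁, h₀, ρ, e₁, e₀, he₁, he₀, hmono, hanti, hoff⟩ :=
    exists_sorted_of_optimal_matching (t := fun i => b * τ i) (θ := θ) hf hg (fun a => (hent a).1)
      (fun k f' g' hf' hg' => by
        have h1 := hmin _ _ |>.trans_eq (hvalue k f' g' hf' hg')
        rw [hU, hV, hvalue r f g hf hg] at h1
        linarith)
  have hT' : T.submatrix id e₁ ∈ orthogonalGroup (Fin d₁) ℝ :=
    mem_orthogonalGroup_of (submatrix_orthonormal hT e₁.injective)
  have hS' : S.submatrix id e₀ ∈ orthogonalGroup (Fin d₀) ℝ :=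
    mem_orthogonalGroup_of (submatrix_orthonormal hS e₀.injective)
  have hτmono : Monotone (τ ∘ e₁) := fun i j hij => le_of_mul_le_mul_left (hmono hij) hb
  have hsort : ∀ i, τ (e₁ i) = sorted σ i := by
    obtain ⟨e, he⟩ := hperm T s hT hTs
    have h1 : Monotone ((fun i => σ i ^ 2) ∘ (e₁.trans e)) := by
      intro i j hij
      have := pow_le_pow_left₀ (hτ _).le (hτmono hij) 2
      simp only [Function.comp, ← hτs, he] at this
      exact this
    have h2 : Monotone ((fun i => σ i ^ 2) ∘ Tuple.sort σ) := fun i j hij =>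
      pow_le_pow_left₀ (hσ _).le (Tuple.monotone_sort σ hij) 2
    intro i
    have h3 := congrFun (Tuple.unique_monotone h1 h2) i
    have h4 : s (e₁ i) = σ (e (e₁ i)) ^ 2 := by rw [he]; rfl
    simp only [Function.comp, Equiv.trans_apply, ← h4, hτs] at h3
    exact (pow_left_inj₀ (hτ _).le (hσ _).le two_ne_zero).1 h3
  have hsing : ∀ j : Fin d₀, singVal Z j = θ (e₀ j) := by
    intro j
    have h1 := sq_singVal_eq Z hS' (mul_submatrix_of_diagonalizes hSc e₀)
      (fun i j hij => by
        simp only [Function.comp, hθc]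
        exact pow_le_pow_left₀ (hθ _).le (hanti hij) 2) j
    rw [Function.comp, hθc] at h1
    exact (pow_left_inj₀ (singVal_nonneg Z j) (hθ _).le two_ne_zero).1 h1
  obtain ⟨R, hR⟩ := exists_isSVD hS' (by
    rw [mul_submatrix_of_diagonalizes hSc e₀]
    congr 2
    ext j
    rw [hsing, Function.comp, hθc]) (fun j => hsing j ▸ hθ _)
  -- Beyond the matched indices, either the threshold is not exceeded by optimality or the singular
  -- values have run out.
  have hzero : ∀ i : Fin d₁, r ≤ (i : ℕ) → encEntry b (sorted σ i) (singVal Z i) = 0 := by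
    intro i hi
    apply encEntry_eq_zero hb (sorted_pos hσ i)
    rcases lt_or_ge (i : ℕ) d₀ with h | h
    · have h1 := hoff i ⟨i, h⟩ rfl hi
      have h2 := hsing ⟨i, h⟩
      rw [← hsort]
      simp only at h2
      rw [h2]
      exact h1
    · rw [singVal_of_le Z h]
      exact (mul_pos hb (sorted_pos hσ i)).le
  have hreindex : ∀ w : Fin r → ℝ,
      T.submatrix id f * diagonal w * (S.submatrix id g)ᵀ =
      (T.submatrix id e₁).submatrix id (Fin.castLE h₁) * diagonal (w ∘ ρ) *
        ((S.submatrix id e₀).submatrix id (Fin.castLE h₀))ᵀ := by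
    intro w
    rw [mul_diagonal_mul_transpose_restrict _ _ _ ρ.injective
      (fun i hi => absurd (ρ.apply_symm_apply i) (hi _))]
    congr 2
    · ext i a; simp [he₁]
    · ext i a; simp [he₀]
  have hcast₁ : ∀ a, sorted σ (Fin.castLE h₁ a) = τ (f (ρ a)) := fun a => by
    rw [← hsort, he₁]
  have hcast₀ : ∀ a : Fin r, singVal Z a = θ (g (ρ a)) := fun a => by
    rw [← he₀]
    exact hsing (Fin.castLE h₀ a)
  have hform : ∀ (w : Fin r → ℝ) (u : Fin d₁ → ℝ), (∀ a, u (Fin.castLE h₁ a) = w (ρ a)) →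
      (∀ i : Fin d₁, r ≤ (i : ℕ) → u i = 0) →
      S.submatrix id g * diagonal w * (T.submatrix id f)ᵀ =
        S.submatrix id e₀ * rectDiag d₀ u * (T.submatrix id e₁)ᵀ := by
    intro w u hu hu0
    have h1 := congrArg transpose (hreindex w)
    simp only [transpose_mul, diagonal_transpose, transpose_transpose, ← Matrix.mul_assoc] at h1
    rw [h1, mul_rectDiag_mul_transpose_restrict h₀ h₁ _ _ _ hu0]
    congr 3
    exact funext fun a => (hu a).symm
  refine ⟨R, S.submatrix id e₀, T.submatrix id e₁, hR, ⟨hT', ?_⟩, ?_, ?_⟩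
  · have h1 := mul_submatrix_of_diagonalizes hTs e₁
    have h2 : encVar (sorted σ) = diagonal (s ∘ e₁) := by
      rw [encVar]
      congr 1
      ext i
      rw [Function.comp, hτs, hsort]
    rw [h2, ← h1, Matrix.mul_assoc, orthogonal_mul_transpose hT', Matrix.mul_one]
  · have h1 := hform (fun a => decEntry b (τ (f a)) (θ (g a)) / θ (g a))
      (fun i => decEntry b (sorted σ i) (singVal Z i) / singVal Z i)
      (fun a => by rw [hcast₁, Fin.val_castLE, hcast₀])
      (fun i hi => by rw [decEntry_eq hb (sorted_pos hσ i), hzero i hi, mul_zero, zero_div])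
    -- The weights on `Z * S` carry a division by `θ`; the factor `Θ` of the decomposition of `Z`
    -- restores it.
    have h2 : rectDiag D₀ (fun i : Fin d₁ => decEntry b (sorted σ i) (singVal Z i)) =
        rectDiag D₀ (fun j : Fin d₀ => singVal Z j) *
          rectDiag d₀ (fun i : Fin d₁ => decEntry b (sorted σ i) (singVal Z i) / singVal Z i) := by
      refine (rectDiag_mul_rectDiag _ _ _ (fun i j hij => ?_) fun i hi => ?_).symm
      · have : singVal Z j ≠ 0 := hsing j ▸ (hθ _).ne'
        rw [hij]
        field_simp
      · rw [decEntry_eq hb (sorted_pos hσ i), encEntry_eq_zero hb (sorted_pos hσ i), mul_zero]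
        rw [singVal_of_le Z hi]
        exact (mul_pos hb (sorted_pos hσ i)).le
    have h3 : Z * S.submatrix id e₀ = R * rectDiag D₀ (fun j : Fin d₀ => singVal Z j) := by
      conv_lhs => rw [hR.2.2]
      rw [Matrix.mul_assoc, orthogonal_transpose_mul hS', Matrix.mul_one]
    rw [hU, h2, Matrix.mul_assoc, Matrix.mul_assoc, ← Matrix.mul_assoc (S.submatrix id g), h1,
      ← Matrix.mul_assoc, ← Matrix.mul_assoc, h3, ← Matrix.mul_assoc]
  · have h1 := hform (fun a => encEntry b (τ (f a)) (θ (g a)))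
      (fun i => encEntry b (sorted σ i) (singVal Z i))
      (fun a => by rw [hcast₁, Fin.val_castLE, hcast₀]) hzero
    have h2 := congrArg transpose h1
    simp only [transpose_mul, diagonal_transpose, transpose_transpose, ← Matrix.mul_assoc] at h2
    rw [hV, h2]

theorem minimizer_iff_canonical {b : ℝ} (hb : 0 < b) {Z : Matrix (Fin D₀) (Fin d₀) ℝ}
    (hZ : ∀ (S : Matrix (Fin d₀) (Fin d₀) ℝ) (c : Fin d₀ → ℝ), S ∈ orthogonalGroup (Fin d₀) ℝ →
      Zᵀ * Z * S = S * diagonal c → ∀ j, 0 < c j)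
    {σ : Fin d₁ → ℝ} (hσ : ∀ i, 0 < σ i) (U : Matrix (Fin D₀) (Fin d₁) ℝ)
    (V : Matrix (Fin d₁) (Fin d₀) ℝ) :
    (∀ U' V', objective b Z (encVar σ) U V ≤ objective b Z (encVar σ) U' V') ↔
    ∃ (R : Matrix (Fin D₀) (Fin D₀) ℝ) (S : Matrix (Fin d₀) (Fin d₀) ℝ)
      (T : Matrix (Fin d₁) (Fin d₁) ℝ), IsSVD Z R S ∧ IsSorting σ T ∧
      U = R * rectDiag D₀ (fun i : Fin d₁ => decEntry b (sorted σ i) (singVal Z i)) * Tᵀ ∧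
      V = T * (rectDiag d₀ (fun i : Fin d₁ => encEntry b (sorted σ i) (singVal Z i)))ᵀ * Sᵀ := by
  refine ⟨canonical_of_minimizer hb hZ hσ, ?_⟩
  -- The common value of all canonical pairs, by orthogonal conjugation to the diagonal model.
  have hval : ∀ U V, (∃ (R : Matrix (Fin D₀) (Fin D₀) ℝ) (S : Matrix (Fin d₀) (Fin d₀) ℝ)
      (T : Matrix (Fin d₁) (Fin d₁) ℝ), IsSVD Z R S ∧ IsSorting σ T ∧
      U = R * rectDiag D₀ (fun i : Fin d₁ => decEntry b (sorted σ i) (singVal Z i)) * Tᵀ ∧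
      V = T * (rectDiag d₀ (fun i : Fin d₁ => encEntry b (sorted σ i) (singVal Z i)))ᵀ * Sᵀ) →
      objective b Z (encVar σ) U V = objective b (rectDiag D₀ fun j : Fin d₀ => singVal Z j)
        (encVar (sorted σ))
        (rectDiag D₀ (fun i : Fin d₁ => decEntry b (sorted σ i) (singVal Z i)))
        (rectDiag d₀ (fun i : Fin d₁ => encEntry b (sorted σ i) (singVal Z i)))ᵀ := by
    rintro U V ⟨R, S, T, ⟨hR, hS, hRS⟩, ⟨hT, hTσ⟩, rfl, rfl⟩
    have h := objective_orthogonal_conj b hR hS hT (rectDiag D₀ fun j : Fin d₀ => singVal Z j)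
      (encVar (sorted σ))
      (rectDiag D₀ (fun i : Fin d₁ => decEntry b (sorted σ i) (singVal Z i)))
      (rectDiag d₀ (fun i : Fin d₁ => encEntry b (sorted σ i) (singVal Z i)))ᵀ
    rwa [← hRS, ← hTσ] at h
  intro h U' V'
  obtain ⟨U₀, V₀, hmin⟩ := exists_objective_minimizer hb Z hσ
  rw [hval U V h, ← hval U₀ V₀ (canonical_of_minimizer hb hZ hσ hmin)]
  exact hmin U' V'

end Minimizers

/-! ### Second moments of the data. -/

section Moments

variable {D₀ d₀ d₁ : ℕ} {μ : Measure (EuclideanSpace ℝ (Fin D₀))}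
  {P : Matrix (Fin D₀) (Fin d₀) ℝ} {φ : Fin d₀ → ℝ}

theorem integrable_mul_coord (hμ : MemLp (fun x : EuclideanSpace ℝ (Fin D₀) => x) 2 μ)
    (i j : Fin D₀) : Integrable (fun x : EuclideanSpace ℝ (Fin D₀) => x i * x j) μ := by
  have h : ∀ i : Fin D₀, MemLp (fun x : EuclideanSpace ℝ (Fin D₀) => x i) 2 μ := fun i =>
    (EuclideanSpace.proj (𝕜 := ℝ) i).comp_memLp' hμ
  exact (h i).integrable_mul (h j)

/-- `Z = A P Φ^{-1/2}` by linearity of the expectation, and `A P = P Φ`. -/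
theorem crossMoment_eq (hμ : MemLp (fun x : EuclideanSpace ℝ (Fin D₀) => x) 2 μ)
    (hP : IsReducedEigenDecomp (secondMoment μ) P φ) :
    crossMoment μ P φ = P * diagonal fun j => √(φ j) := by
  have h1 : crossMoment μ P φ = secondMoment μ * P * diagonal fun j => (√(φ j))⁻¹ := by
    ext i j
    rw [mul_diagonal, Matrix.mul_apply, Finset.sum_mul]
    simp only [crossMoment, secondMoment, whiten, Matrix.of_apply, Matrix.mulVec, dotProduct,
      diagonal_mul, transpose_apply, Finset.mul_sum]
    rw [integral_finsetSum]
    · refine Finset.sum_congr rfl fun k _ => ?_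
      rw [mul_assoc, ← integral_mul_const]
      refine integral_congr_ae (Filter.Eventually.of_forall fun x => ?_)
      simp only
      ring
    · intro k _
      refine ((integrable_mul_coord hμ i k).const_mul ((√(φ j))⁻¹ * P k j)).congr
        (Filter.Eventually.of_forall fun x => ?_)
      simp only
      ring
  rw [h1, hP.eq, Matrix.mul_assoc _ Pᵀ, hP.orthonormal, Matrix.mul_one, Matrix.mul_assoc,
    diagonal_mul_diagonal]
  congr 2
  ext j
  have := Real.sqrt_pos.2 (hP.pos j)
  field_simp
  rw [Real.sq_sqrt (hP.pos j).le]

theorem gram_crossMoment (hμ : MemLp (fun x : EuclideanSpace ℝ (Fin D₀) => x) 2 μ)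
    (hP : IsReducedEigenDecomp (secondMoment μ) P φ) :
    (crossMoment μ P φ)ᵀ * crossMoment μ P φ = diagonal φ := by
  rw [crossMoment_eq hμ hP, transpose_mul, diagonal_transpose, Matrix.mul_assoc,
    ← Matrix.mul_assoc Pᵀ, hP.orthonormal, Matrix.one_mul, diagonal_mul_diagonal]
  congr 1
  ext j
  exact Real.mul_self_sqrt (hP.pos j).le

theorem integral_sq_mulVec (hμ : MemLp (fun x : EuclideanSpace ℝ (Fin D₀) => x) 2 μ)
    (W : Matrix (Fin d₁) (Fin D₀) ℝ) (i : Fin d₁) :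
    Integrable (fun x : EuclideanSpace ℝ (Fin D₀) => (W *ᵥ x.ofLp) i ^ 2) μ ∧
      ∫ x, (W *ᵥ x.ofLp) i ^ 2 ∂μ = (W * secondMoment μ * Wᵀ) i i := by
  have h : (fun x : EuclideanSpace ℝ (Fin D₀) => (W *ᵥ x.ofLp) i ^ 2) =
      fun x => ∑ k, ∑ l, W i k * W i l * (x k * x l) := by
    ext x
    simp only [Matrix.mulVec, dotProduct, sq, Finset.sum_mul_sum]
    exact Finset.sum_congr rfl fun k _ => Finset.sum_congr rfl fun l _ => by ring
  have hint : ∀ k l, Integrable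
      (fun x : EuclideanSpace ℝ (Fin D₀) => W i k * W i l * (x k * x l)) μ :=
    fun k l => (integrable_mul_coord hμ k l).const_mul _
  rw [h]
  refine ⟨integrable_finsetSum _ fun k _ => integrable_finsetSum _ fun l _ => hint k l, ?_⟩
  rw [integral_finsetSum _ fun k _ => integrable_finsetSum _ fun l _ => hint k l]
  simp only [Matrix.mul_apply, transpose_apply, Finset.sum_mul]
  rw [Finset.sum_comm]
  refine Finset.sum_congr rfl fun k _ => ?_
  rw [integral_finsetSum _ fun l _ => hint k l]
  refine Finset.sum_congr rfl fun l _ => ?_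
  rw [integral_const_mul, secondMoment, Matrix.of_apply]
  ring

end Moments

/-! ### Collapsed dimensions as zero rows. -/

section Collapse

variable {D₀ d₀ d₁ : ℕ} {μ : Measure (EuclideanSpace ℝ (Fin D₀))}
  {P : Matrix (Fin D₀) (Fin d₀) ℝ} {φ : Fin d₀ → ℝ}

theorem encVar_posSemidef (σ : Fin d₁ → ℝ) : (encVar σ).PosSemidef :=
  PosSemidef.diagonal fun i => sq_nonneg (σ i)

/-- The marginal is Gaussian with mean `(W x)_i` and already the right variance, so only the mean
matters. -/
theorem encoder_marginal_eq_iff (W : Matrix (Fin d₁) (Fin D₀) ℝ) (σ : Fin d₁ → ℝ) (i : Fin d₁)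
    (x : EuclideanSpace ℝ (Fin D₀)) :
    (encoder W (encVar σ) x).map (fun z => z i) = gaussianReal 0 (encVar σ i i).toNNReal ↔
      (W *ᵥ x.ofLp) i = 0 := by
  rw [encoder, (measurePreserving_eval_multivariateGaussian (encVar_posSemidef σ)).map_eq,
    gaussianReal_ext_iff]
  simp

/-- `(W x)_i` vanishes almost everywhere iff its second moment `(W A Wᵀ)_ii = (V Vᵀ)_ii` is zero,
and that is the squared length of row `i` of `V`. -/
theorem collapsedDims_eq (hμ : MemLp (fun x : EuclideanSpace ℝ (Fin D₀) => x) 2 μ)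
    (hP : IsReducedEigenDecomp (secondMoment μ) P φ) {W : Matrix (Fin d₁) (Fin D₀) ℝ}
    {V : Matrix (Fin d₁) (Fin d₀) ℝ} (hW : IsEncoderOf P φ W V) (σ : Fin d₁ → ℝ) :
    collapsedDims μ W (encVar σ) = {i | ∀ j, V i j = 0} := by
  ext i
  obtain ⟨hint, hval⟩ := integral_sq_mulVec hμ W i
  have hVV : W * secondMoment μ * Wᵀ = V * Vᵀ := by
    rw [← hW, hP.eq, transpose_mul, transpose_mul, diagonal_transpose]
    have : diagonal φ = diagonal (fun j => √(φ j)) * diagonal (fun j => √(φ j)) := by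
      rw [diagonal_mul_diagonal]
      congr 1
      ext j
      exact (Real.mul_self_sqrt (hP.pos j).le).symm
    rw [this]
    simp only [Matrix.mul_assoc]
  have h1 : (∀ᵐ x ∂μ, (W *ᵥ x.ofLp) i = 0) ↔ ∫ x, (W *ᵥ x.ofLp) i ^ 2 ∂μ = 0 := by
    rw [integral_eq_zero_iff_of_nonneg (fun x => sq_nonneg _) hint]
    refine Filter.eventually_congr (Filter.Eventually.of_forall fun x => ?_)
    simp
  simp only [collapsedDims, Set.mem_ofPred_eq, encoder_marginal_eq_iff]
  rw [h1, hval, hVV, Matrix.mul_apply]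
  simp only [transpose_apply]
  rw [Finset.sum_eq_zero_iff_of_nonneg fun j _ => mul_self_nonneg (V i j)]
  simp

theorem ncard_zero_rows_le (V : Matrix (Fin d₁) (Fin d₀) ℝ) :
    {i | ∀ j, V i j = 0}.ncard ≤ d₁ - V.rank := by
  classical
  set N : Finset (Fin d₁) := Finset.univ.filter fun i => ¬ ∀ j, V i j = 0 with hN
  have hrank : V.rank ≤ N.card := by
    rw [rank_eq_finrank_span_row]
    have hle : Submodule.span ℝ (Set.range V.row) ≤
        Submodule.span ℝ ((N.image V.row : Finset (Fin d₀ → ℝ)) : Set (Fin d₀ → ℝ)) := by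
      rw [Submodule.span_le]
      rintro _ ⟨i, rfl⟩
      by_cases hi : ∀ j, V i j = 0
      · have : V.row i = 0 := funext hi
        rw [this]
        exact Submodule.zero_mem _
      · exact Submodule.subset_span (by
          rw [Finset.coe_image]
          exact ⟨i, by simpa [hN] using hi, rfl⟩)
    exact (Submodule.finrank_mono hle).trans
      ((finrank_span_finset_le_card _).trans Finset.card_image_le)
  have hcard : {i | ∀ j, V i j = 0}.ncard + N.card = d₁ := by
    rw [Set.ncard_eq_toFinset_card']
    have := Finset.card_filter_add_card_filter_not (s := (Finset.univ : Finset (Fin d₁)))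
      (fun i => ∀ j, V i j = 0)
    simpa [hN] using this
  omega

end Collapse

/-! ### Ranks and prescribed zero rows in the isotropic case. -/

section Isotropic

variable {D₀ d₀ d₁ : ℕ}

theorem rank_rectDiag {m n : ℕ} (w : Fin n → ℝ) (hw : ∀ i : Fin n, m ≤ (i : ℕ) → w i = 0) :
    (rectDiag m w).rank = {i | w i ≠ 0}.ncard := by
  classical
  have h : (rectDiag m w)ᵀ * rectDiag m w = diagonal fun i => w i ^ 2 := by
    ext i j
    rw [mul_rectDiag_apply]
    by_cases hij : i = j
    · subst hij
      rw [diagonal_apply_eq]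
      split_ifs with hi
      · simp [rectDiag, sq]
      · rw [hw i (not_lt.1 hi), sq, mul_zero]
    · rw [diagonal_apply_ne _ hij]
      split_ifs with hj
      · simp only [rectDiag, transpose_apply, Matrix.of_apply]
        rw [if_neg fun e => hij (Fin.ext e.symm), zero_mul]
      · rfl
  rw [← rank_transpose_mul_self, h, rank_diagonal, Set.ncard_eq_toFinset_card']
  simp [Fintype.card_subtype]

theorem rank_orthogonal_conj {m n : ℕ} {T : Matrix (Fin m) (Fin m) ℝ}
    {S : Matrix (Fin n) (Fin n) ℝ} (hT : T ∈ orthogonalGroup (Fin m) ℝ)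
    (hS : S ∈ orthogonalGroup (Fin n) ℝ) (M : Matrix (Fin m) (Fin n) ℝ) :
    (T * M * Sᵀ).rank = M.rank := by
  refine le_antisymm ((rank_mul_le_left _ _).trans (rank_mul_le_right _ _)) ?_
  have h : M = Tᵀ * (T * M * Sᵀ) * S := by
    rw [Matrix.mul_assoc T, ← Matrix.mul_assoc Tᵀ, orthogonal_transpose_mul hT, Matrix.one_mul,
      Matrix.mul_assoc, orthogonal_transpose_mul hS, Matrix.mul_one]
  conv_lhs => rw [h]
  exact (rank_mul_le_left _ _).trans (rank_mul_le_right _ _)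

/-- The indices above a threshold form an initial segment, which is therefore determined by its
size. -/
theorem lt_iff_lt_ncard_of_antitone {n : ℕ} {θ : ℕ → ℝ} (hθ : Antitone θ) (x : ℝ) (i : Fin n) :
    x < θ i ↔ (i : ℕ) < {j : Fin n | x < θ j}.ncard := by
  classical
  rw [Set.ncard_eq_toFinset_card']
  constructor
  · intro h
    have : Finset.Iic i ⊆ {j : Fin n | x < θ j}.toFinset := fun j hj => by
      simpa using h.trans_le (hθ (Fin.le_def.1 (Finset.mem_Iic.1 hj)))
    have := Finset.card_le_card this
    rw [Fin.card_Iic] at this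
    omega
  · intro h
    by_contra hx
    have : {j : Fin n | x < θ j}.toFinset ⊆ Finset.Iio i := fun j hj => by
      rw [Finset.mem_Iio]
      by_contra hij
      exact hx ((Set.mem_toFinset.1 hj).trans_le (hθ (Fin.le_def.1 (not_lt.1 hij))))
    have := Finset.card_le_card this
    rw [Fin.card_Iio] at this
    omega

/-- There are orthonormal columns with any admissible number of zero rows. -/
theorem exists_orthonormal_columns_zero_rows {n r k : ℕ} (hr : 1 ≤ r) (hk : k + r ≤ n) :
    ∃ M : Matrix (Fin n) (Fin r) ℝ, Mᵀ * M = 1 ∧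
      ∀ i : Fin n, (∀ a, M i a = 0) ↔ n - k ≤ (i : ℕ) := by
  classical
  -- Partition of the first `n - k` rows into `r` blocks: singletons, then one last block absorbing
  -- the rest. The columns are the normalized block indicators.
  set B : Fin r → Finset (Fin n) := fun a =>
    Finset.univ.filter fun i => (i : ℕ) < n - k ∧ min (i : ℕ) (r - 1) = a with hB
  have hne : ∀ a, 0 < (B a).card := by
    intro a
    refine Finset.card_pos.2 ⟨⟨a, by omega⟩, ?_⟩
    simp only [hB, Finset.mem_filter, Finset.mem_univ, true_and]
    omega
  refine ⟨Matrix.of fun i a => if i ∈ B a then (√((B a).card : ℝ))⁻¹ else 0, ?_, ?_⟩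
  · ext a c
    rw [Matrix.mul_apply, one_apply]
    simp only [transpose_apply, Matrix.of_apply]
    split_ifs with hac
    · subst hac
      have hc : (0 : ℝ) < (B a).card := by exact_mod_cast hne a
      have : ∀ i, (if i ∈ B a then (√((B a).card : ℝ))⁻¹ else 0) *
          (if i ∈ B a then (√((B a).card : ℝ))⁻¹ else 0) =
          if i ∈ B a then ((B a).card : ℝ)⁻¹ else 0 := by
        intro i
        split_ifs
        · rw [← mul_inv, Real.mul_self_sqrt hc.le]
        · simp
      simp only [this]
      rw [Finset.sum_ite_mem, Finset.univ_inter, Finset.sum_const, nsmul_eq_mul,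
        mul_inv_cancel₀ hc.ne']
    · refine Finset.sum_eq_zero fun i _ => ?_
      split_ifs with h1 h2
      · simp only [hB, Finset.mem_filter] at h1 h2
        exact absurd (Fin.ext (h1.2.2.symm.trans h2.2.2)) hac
      all_goals simp
  · intro i
    simp only [Matrix.of_apply]
    constructor
    · intro h
      by_contra! hlt
      have h1 := h ⟨min (i : ℕ) (r - 1), by omega⟩
      rw [if_pos (Finset.mem_filter.2 ⟨Finset.mem_univ _, hlt, rfl⟩)] at h1
      have h2 := hne ⟨min (i : ℕ) (r - 1), by omega⟩
      have : (0 : ℝ) < (B ⟨min (i : ℕ) (r - 1), by omega⟩).card := by exact_mod_cast h2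
      exact (inv_pos.2 (Real.sqrt_pos.2 this)).ne' h1
    · intro h a
      rw [if_neg]
      simp only [hB, Finset.mem_filter]
      omega

theorem isSorting_const {σ : Fin d₁ → ℝ} {s : ℝ} (hσ : ∀ i, σ i = s)
    {T : Matrix (Fin d₁) (Fin d₁) ℝ} (hT : T ∈ orthogonalGroup (Fin d₁) ℝ) : IsSorting σ T := by
  refine ⟨hT, ?_⟩
  have h : ∀ τ : Fin d₁ → ℝ, (∀ i, τ i = s) → encVar τ = s ^ 2 • 1 := by
    intro τ hτ
    rw [encVar, smul_one_eq_diagonal]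
    simp only [hτ]
  rw [h σ hσ, h (sorted σ) fun i => hσ _, Matrix.mul_smul, Matrix.mul_one, Matrix.smul_mul,
    orthogonal_mul_transpose hT]

theorem ncard_le_val {n k : ℕ} (hk : k ≤ n) : {i : Fin n | n - k ≤ (i : ℕ)}.ncard = k := by
  rw [Set.ncard_eq_toFinset_card']
  have h := Finset.card_filter_add_card_filter_not (s := (Finset.univ : Finset (Fin n)))
      (fun i => (i : ℕ) < n - k)
  rw [Fin.card_filter_val_lt] at h
  simp only [not_lt, Finset.card_univ, Fintype.card_fin] at h
  simp only [Set.toFinset_ofPred]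
  omega

/-- A canonical pair can be chosen such that its encoder factor has a prescribed number of zero
rows. -/
theorem exists_orthogonal_zero_rows {S : Matrix (Fin d₀) (Fin d₀) ℝ}
    (hS : S ∈ orthogonalGroup (Fin d₀) ℝ) {w : Fin d₁ → ℝ} {r k : ℕ} (hr : 1 ≤ r)
    (hr₀ : r ≤ d₀) (hk : k + r ≤ d₁) (hw : ∀ i : Fin d₁, w i ≠ 0 ↔ (i : ℕ) < r) :
    ∃ T ∈ orthogonalGroup (Fin d₁) ℝ,
      {i | ∀ j, (T * (rectDiag d₀ w)ᵀ * Sᵀ) i j = 0}.ncard = k := by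
  obtain ⟨M, hM, hrow⟩ := exists_orthonormal_columns_zero_rows hr hk
  obtain ⟨h₁, T, -, -, hT, hTM, -, -⟩ := exists_orthogonal_extension
    (A := (0 : Matrix (Fin d₁) (Fin d₁) ℝ)) (B := 0) (by simp) (by simp) rfl M hM 0 0
    (by ext; simp) (by ext; simp)
  refine ⟨T, hT, ?_⟩
  have hV : T * (rectDiag d₀ w)ᵀ * Sᵀ =
      M * diagonal (w ∘ Fin.castLE h₁) * (S.submatrix id (Fin.castLE hr₀))ᵀ := by
    have h := congrArg transpose (mul_rectDiag_mul_transpose_restrict hr₀ h₁ S T w fun i hi => by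
      by_contra hne
      exact absurd ((hw i).1 hne) (not_lt.2 hi))
    simp only [transpose_mul, diagonal_transpose, transpose_transpose, ← Matrix.mul_assoc] at h
    rw [h, hTM]
  -- The first `r` columns of `S` undo the right factor; as the remaining weights are nonzero, the
  -- zero rows are those of `M`.
  have hVS : T * (rectDiag d₀ w)ᵀ * Sᵀ * S.submatrix id (Fin.castLE hr₀) =
      M * diagonal (w ∘ Fin.castLE h₁) := by
    rw [hV, Matrix.mul_assoc, submatrix_orthonormal hS (Fin.castLE_injective hr₀), Matrix.mul_one]
  have hset : {i | ∀ j, (T * (rectDiag d₀ w)ᵀ * Sᵀ) i j = 0} = {i : Fin d₁ | d₁ - k ≤ (i : ℕ)} := by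
    ext i
    rw [Set.mem_ofPred_eq, Set.mem_ofPred_eq, ← hrow]
    constructor
    · intro h a
      have h1 := congrFun (congrFun hVS i) a
      rw [mul_diagonal, Matrix.mul_apply, Finset.sum_eq_zero fun j _ => by rw [h j, zero_mul]] at h1
      exact (mul_eq_zero.1 h1.symm).resolve_right ((hw _).2 a.2)
    · intro h j
      rw [hV, Matrix.mul_apply]
      exact Finset.sum_eq_zero fun a _ => by rw [mul_diagonal, h a, zero_mul, zero_mul]
  rw [hset, ncard_le_val (by omega)]

/-- The witness `V Φ^{-1/2} Pᵀ` kills the orthogonal complement of the columns of `P`, where an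
encoder of `V` is otherwise free and could gain rank. -/
theorem exists_encoder_rank_eq {P : Matrix (Fin D₀) (Fin d₀) ℝ} {φ : Fin d₀ → ℝ} (hP : Pᵀ * P = 1)
    (hφ : ∀ j, 0 < φ j) (V : Matrix (Fin d₁) (Fin d₀) ℝ) :
    ∃ W, IsEncoderOf P φ W V ∧ W.rank = V.rank := by
  have h : IsEncoderOf P φ (V * diagonal (fun j => (√(φ j))⁻¹) * Pᵀ) V := by
    rw [IsEncoderOf, Matrix.mul_assoc _ Pᵀ, hP, Matrix.mul_one, Matrix.mul_assoc,
      diagonal_mul_diagonal]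
    have : (fun j => (√(φ j))⁻¹ * √(φ j)) = fun _ => 1 :=
      funext fun j => inv_mul_cancel₀ (Real.sqrt_pos.2 (hφ j)).ne'
    rw [this, diagonal_one, Matrix.mul_one]
  refine ⟨_, h, le_antisymm ((rank_mul_le_left _ _).trans (rank_mul_le_left _ _)) ?_⟩
  conv_lhs => rw [← h, Matrix.mul_assoc]
  exact rank_mul_le_left _ _

end Isotropic

/-! ### The stated entries in terms of `b`. -/

section Main

variable {D₀ d₀ d₁ : ℕ} {β ηdec ηenc : ℝ} {Z : Matrix (Fin D₀) (Fin d₀) ℝ} {σ : Fin d₁ → ℝ}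

theorem lam_eq_encEntry :
    lam β ηdec ηenc Z σ =
      fun i : Fin d₁ => encEntry (√β * (ηdec / ηenc)) (sorted σ i) (singVal Z i) := by
  ext i
  rw [lam, encEntry]
  congr 2
  have : ηenc * sorted σ i / (√β * ηdec) = sorted σ i / (√β * (ηdec / ηenc)) := by
    rw [mul_div_assoc', div_div_eq_mul_div, mul_comm (sorted σ i)]
  rw [this]
  ring

theorem omega_eq_decEntry :
    omega β ηdec ηenc Z σ =
      fun i : Fin d₁ => decEntry (√β * (ηdec / ηenc)) (sorted σ i) (singVal Z i) := by
  ext i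
  rw [omega, decEntry]
  congr 2
  have : √β * ηdec / (ηenc * sorted σ i) = √β * (ηdec / ηenc) / sorted σ i := by
    rw [mul_div_assoc', div_div]
  rw [this]
  ring

theorem lam_ne_zero_iff (hβ : 0 < β) (hdec : 0 < ηdec) (henc : 0 < ηenc) (hσ : ∀ i, 0 < σ i)
    {s : ℝ} (hs : ∀ i, σ i = s) (i : Fin d₁) :
    lam β ηdec ηenc Z σ i ≠ 0 ↔ √β * s * (ηdec / ηenc) < singVal Z i := by
  have hb : 0 < √β * (ηdec / ηenc) := mul_pos (Real.sqrt_pos.2 hβ) (div_pos hdec henc)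
  have hi : sorted σ i = s := hs _
  have hcomm : √β * s * (ηdec / ηenc) = √β * (ηdec / ηenc) * sorted σ i := by rw [hi]; ring
  rw [lam_eq_encEntry, hcomm]
  constructor
  · intro h
    by_contra! hle
    exact h (encEntry_eq_zero hb (sorted_pos hσ i) hle)
  · intro h
    exact (encEntry_pos hb (sorted_pos hσ i) h).ne'

end Main

end LinearVAE

theorem theorem2 {D₀ d₀ d₁ : ℕ}
    (μ : Measure (EuclideanSpace ℝ (Fin D₀))) [IsProbabilityMeasure μ]
    (hμ : MemLp (fun x : EuclideanSpace ℝ (Fin D₀) => x) 2 μ)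
    (P : Matrix (Fin D₀) (Fin d₀) ℝ) (φ : Fin d₀ → ℝ)
    (hP : LinearVAE.IsReducedEigenDecomp (LinearVAE.secondMoment μ) P φ)
    (Z : Matrix (Fin D₀) (Fin d₀) ℝ) (hZ : Z = LinearVAE.crossMoment μ P φ)
    (β ηdec ηenc : ℝ) (hβ : 0 < β) (hdec : 0 < ηdec) (henc : 0 < ηenc)
    (σ : Fin d₁ → ℝ) (hσ : ∀ i, 0 < σ i) :
    -- minimizers exist
    (∃ (U : Matrix (Fin D₀) (Fin d₁) ℝ) (V : Matrix (Fin d₁) (Fin d₀) ℝ),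
      LinearVAE.IsMinimizer β ηdec ηenc Z (LinearVAE.encVar σ) U V) ∧
    -- they are exactly the pairs `(R Ω Tᵀ, T Λ Sᵀ)`
    (∀ (U : Matrix (Fin D₀) (Fin d₁) ℝ) (V : Matrix (Fin d₁) (Fin d₀) ℝ),
      LinearVAE.IsMinimizer β ηdec ηenc Z (LinearVAE.encVar σ) U V ↔
        ∃ (R : Matrix (Fin D₀) (Fin D₀) ℝ) (S : Matrix (Fin d₀) (Fin d₀) ℝ)
          (T : Matrix (Fin d₁) (Fin d₁) ℝ),
          LinearVAE.IsSVD Z R S ∧ LinearVAE.IsSorting σ T ∧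
          U = R * LinearVAE.rectDiag D₀ (LinearVAE.omega β ηdec ηenc Z σ) * Tᵀ ∧
          V = T * (LinearVAE.rectDiag d₀ (LinearVAE.lam β ηdec ηenc Z σ))ᵀ * Sᵀ) ∧
    -- at a minimizer, the collapsed latent dimensions are the zero rows of `V`
    (∀ (U : Matrix (Fin D₀) (Fin d₁) ℝ) (V : Matrix (Fin d₁) (Fin d₀) ℝ)
      (W : Matrix (Fin d₁) (Fin D₀) ℝ),
      LinearVAE.IsMinimizer β ηdec ηenc Z (LinearVAE.encVar σ) U V →
      LinearVAE.IsEncoderOf P φ W V →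
        LinearVAE.collapsedDims μ W (LinearVAE.encVar σ) = {i | ∀ j, V i j = 0} ∧
        (LinearVAE.collapsedDims μ W (LinearVAE.encVar σ)).ncard ≤ d₁ - V.rank) ∧
    -- isotropic case
    (∀ s : ℝ, (∀ i, σ i = s) → ∀ r : ℕ,
      r = {i : Fin d₁ | √β * s * (ηdec / ηenc) < LinearVAE.singVal Z i}.ncard →
        (∀ (U : Matrix (Fin D₀) (Fin d₁) ℝ) (V : Matrix (Fin d₁) (Fin d₀) ℝ),
          LinearVAE.IsMinimizer β ηdec ηenc Z (LinearVAE.encVar σ) U V → V.rank = r) ∧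
        (1 ≤ r → ∀ k : ℕ, k ≤ d₁ - r →
          ∃ (U : Matrix (Fin D₀) (Fin d₁) ℝ) (V : Matrix (Fin d₁) (Fin d₀) ℝ)
            (W : Matrix (Fin d₁) (Fin D₀) ℝ),
            LinearVAE.IsMinimizer β ηdec ηenc Z (LinearVAE.encVar σ) U V ∧
            LinearVAE.IsEncoderOf P φ W V ∧ W.rank = r ∧
            (LinearVAE.collapsedDims μ W (LinearVAE.encVar σ)).ncard = k)) := by
  have hb : 0 < √β * (ηdec / ηenc) := mul_pos (Real.sqrt_pos.2 hβ) (div_pos hdec henc)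
  -- `Zᵀ Z = Φ`, so any diagonalization lists the positive `φ j`.
  have hZpos : ∀ (S : Matrix (Fin d₀) (Fin d₀) ℝ) (c : Fin d₀ → ℝ),
      S ∈ orthogonalGroup (Fin d₀) ℝ → Zᵀ * Z * S = S * diagonal c → ∀ j, 0 < c j := by
    intro S c hS h j
    rw [hZ, LinearVAE.gram_crossMoment hμ hP] at h
    obtain ⟨e, rfl⟩ := LinearVAE.exists_perm_of_diagonalizations hS h
    exact hP.pos _
  have hiff : ∀ (U : Matrix (Fin D₀) (Fin d₁) ℝ) (V : Matrix (Fin d₁) (Fin d₀) ℝ),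
      LinearVAE.IsMinimizer β ηdec ηenc Z (LinearVAE.encVar σ) U V ↔
        ∃ (R : Matrix (Fin D₀) (Fin D₀) ℝ) (S : Matrix (Fin d₀) (Fin d₀) ℝ)
          (T : Matrix (Fin d₁) (Fin d₁) ℝ),
          LinearVAE.IsSVD Z R S ∧ LinearVAE.IsSorting σ T ∧
          U = R * LinearVAE.rectDiag D₀ (LinearVAE.omega β ηdec ηenc Z σ) * Tᵀ ∧
          V = T * (LinearVAE.rectDiag d₀ (LinearVAE.lam β ηdec ηenc Z σ))ᵀ * Sᵀ := by
    intro U V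
    rw [LinearVAE.isMinimizer_iff hβ hdec, LinearVAE.minimizer_iff_canonical hb hZpos hσ,
      LinearVAE.omega_eq_decEntry, LinearVAE.lam_eq_encEntry]
  obtain ⟨U₀, V₀, hmin₀⟩ : ∃ (U : Matrix (Fin D₀) (Fin d₁) ℝ) (V : Matrix (Fin d₁) (Fin d₀) ℝ),
      LinearVAE.IsMinimizer β ηdec ηenc Z (LinearVAE.encVar σ) U V := by
    obtain ⟨U, V, h⟩ := LinearVAE.exists_objective_minimizer hb Z hσ
    exact ⟨U, V, (LinearVAE.isMinimizer_iff hβ hdec Z _ U V).2 h⟩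
  refine ⟨⟨U₀, V₀, hmin₀⟩, hiff, fun U V W _ hW => ?_, fun s hs r hr => ?_⟩
  · have h := LinearVAE.collapsedDims_eq hμ hP hW σ
    exact ⟨h, h ▸ LinearVAE.ncard_zero_rows_le V⟩
  have hlam := LinearVAE.lam_ne_zero_iff (Z := Z) hβ hdec henc hσ hs
  have hrank : ∀ (U : Matrix (Fin D₀) (Fin d₁) ℝ) (V : Matrix (Fin d₁) (Fin d₀) ℝ),
      LinearVAE.IsMinimizer β ηdec ηenc Z (LinearVAE.encVar σ) U V → V.rank = r := by
    intro U V h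
    obtain ⟨R, S, T, hRS, hT, -, rfl⟩ := (hiff U V).1 h
    rw [LinearVAE.rank_orthogonal_conj hT.1 hRS.2.1, rank_transpose, LinearVAE.rank_rectDiag, hr]
    · simp only [hlam]
    · intro i hi
      by_contra hne
      have h1 := (hlam i).1 hne
      rw [LinearVAE.singVal_of_le Z hi] at h1
      have h2 : 0 < s := hs i ▸ hσ i
      have : 0 < √β * s * (ηdec / ηenc) :=
        mul_pos (mul_pos (Real.sqrt_pos.2 hβ) h2) (div_pos hdec henc)
      linarith
  refine ⟨hrank, fun hr1 k hk => ?_⟩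
  have hr₀ : r ≤ d₀ := hrank U₀ V₀ hmin₀ ▸ V₀.rank_le_width
  have hr₁ : r ≤ d₁ := hrank U₀ V₀ hmin₀ ▸ V₀.rank_le_height
  -- A singular value decomposition is borrowed from an existing minimizer; only its `T` is
  -- replaced.
  obtain ⟨R, S, -, hRS, -⟩ := (hiff U₀ V₀).1 hmin₀
  obtain ⟨T, hT, hcard⟩ := LinearVAE.exists_orthogonal_zero_rows hRS.2.1
    (w := LinearVAE.lam β ηdec ηenc Z σ) (k := k) hr1 hr₀ (by omega) (fun i => by
      rw [hlam, LinearVAE.lt_iff_lt_ncard_of_antitone (LinearVAE.singVal_antitone Z), ← hr])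
  have hmin := (hiff _ _).2 ⟨R, S, T, hRS, LinearVAE.isSorting_const hs hT, rfl, rfl⟩
  obtain ⟨W, hW, hWr⟩ := LinearVAE.exists_encoder_rank_eq hP.orthonormal hP.pos
    (T * (LinearVAE.rectDiag d₀ (LinearVAE.lam β ηdec ηenc Z σ))ᵀ * Sᵀ)
  refine ⟨_, _, W, hmin, hW, hWr.trans (hrank _ _ hmin), ?_⟩
  rw [LinearVAE.collapsedDims_eq hμ hP hW σ, hcard]
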